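/- **Setting.** Let $Y$ be a mildly singular $C^\infty$ $n$-manifold with corners ($n\ge 1$): there is a closed discrete set $Y_{sing}\subset Y$ such that $Y\setminus Y_{sing}$ is a paracompact Hausdorff $C^\infty$ $n$-manifold with corners, whose boundary is closed in $Y$, and each $p\in Y_{sing}$ has a fixed open neighbourhood, away from the boundary and from the other singularities, which is homeomorphic to an open cone (apex $p$) over a connected closed topological $(n-1)$-manifold and comes with a topological embedding into some $\mathbb R^{l_p}$, $l_p>n$, that is smooth off $p$. A function is smooth if it is smooth on $Y\setminus Y_{sing}$ and, near each singularity $p$, is the restriction of a smooth function on $\mathbb R^{l_p}$; let $\mathcal O_Y$ be the sheaf of smooth real functions and $\mathcal O_Y^{\mathbb C}=\mathcal O_Y\otimes_{\mathbb R}\mathbb C$. A mildly singular vector bundle is an $\mathcal O_Y^{\mathbb C}$-module that is locally free of finite rank on $Y\setminus Y_{sing}$ and locally finitely generated at the singularities. Let $Y$ be decomposed into connected blocks by a regular partition: locally on $Y\setminus Y_{sing}$ the blocks are the $2^k$ coordinate quadrants of a chart, for some $k\ge0$ (the points where this happens with a given $k\geq 1$ form the codimension-$k$ stratum, and the closures of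 its connected components are the codimension-$k$ facets), and every singularity is interior to one block and off the others. Let $\mathfrak S$ be a tame $C^\infty$ complex vector bundle settlement: on each block a bundle, the restriction of a mildly singular bundle on an open neighbourhood of the block, and along facets fibrewise injective clutching maps between the bundles of two blocks that contain the facet, extending to bundle embeddings near the facet, such that * each codimension-one facet carries exactly one clutching map along it; * at each point $p$ the quiver whose vertices are the blocks through $p$ and whose arrows are the clutching maps along facets through $p$ is saturated (some vertex is reached from all vertices by directed paths), and clutching maps along a facet of codimension $k\ge2$ are assigned only where those in lower codimension do not yet give a saturated quiver; * over each facet the composite of clutching maps along a path depends only on the ends of the path, and is the identity for a loop; * (tameness) each point $p$ has a neighbourhood on which bundle maps, fibrewise injective over the blocks at smooth points, are given from the bundles of the blocks through $p$ to the extended bundle of a distinguished block at $p$ (a terminal vertex of the quiver at $p$); they are compatible with the clutching maps over the facets and the identity on the distinguished block. Let $\mathcal S_{\mathfrak S}$ be the $\mathcal O_Y^{\mathbb C}$-module of smooth sections of $\mathfrak S$: families of elements of the fibres of the distinguished blocks that are given, in each of the local bundle charts just described, by smooth sections of the extended bundle of the distinguished block (at a singularity, the sections of that bundle). Put $\mathcal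 O^{nc}=\mathcal End_{\mathcal O_Y^{\mathbb C}}(\mathcal S_{\mathfrak S})$, so that $Y^{nc}=(Y,\mathcal O^{nc})$ is a $C^\infty$ Azumaya-type noncommutative ringed space. Let $\mathcal T_*Y^{nc}$ be the $\mathcal O_Y^{\mathbb C}$-module of derivations of $\mathcal O^{nc}$: local sections over $U$ are the $\mathbb C$-linear sheaf maps $\xi:\mathcal O^{nc}|_U\to\mathcal O^{nc}|_U$ with $\xi(ab)=(\xi a)b+a(\xi b)$ and the $C^\infty$ chain rule $\xi(h(f_1,\dots,f_s))=\sum_i(\partial_ih)(f_1,\dots,f_s)\,\xi f_i$ for $h\in C^\infty(\mathbb R^s)$ and $f_i$ local sections of $\mathcal O_Y$. Let $\mathcal T^*Y^{nc}$ be the sheaf of differentials, the bi-$\mathcal O^{nc}$-module whose stalk at $q$ is the bimodule over $R=\mathcal O^{nc}_q$ generated by symbols $dr$, $r\in R$, subject to $\mathbb C$-linearity (for left and for right scalars), $d(rs)=(dr)s+r\,ds$, $(dr)z=z\,dr$ for $z$ in the centre of $R$, and $d(h(f_1,\dots,f_s))=\sum_i(\partial_ih)(f_1,\dots,f_s)\,df_i$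 for $h\in C^\infty(\mathbb R^s)$ and $f_i\in\mathcal O_{Y,q}$; its local sections are locally finite sums of terms $a\,(db)\,c$ with $a,b,c$ local sections of $\mathcal O^{nc}$. **Lemma.** There is an isomorphism of $\mathcal O_Y^{\mathbb C}$-modules $$\iota:\mathcal T_*Y^{nc}\;\cong\;\mathcal Hom_{\mathrm{bi}\text{-}\mathcal O^{nc}}(\mathcal T^*Y^{nc},\mathcal O^{nc}),\qquad \iota(\xi)(a\,(db)\,c)=a\,(\xi b)\,c .$$ The resulting $\mathcal O_Y^{\mathbb C}$-linear pairing $\mathcal T_*Y^{nc}\otimes_{\mathcal O_Y^{\mathbb C}}\mathcal T^*Y^{nc}\to\mathcal O^{nc}$, $\xi\otimes\omega\mapsto\iota(\xi)(\omega)$, is given by $\xi\otimes a\,(db)\,c\mapsto a\,(\xi b)\,c$ and is nondegenerate in the $\mathcal T_*Y^{nc}$-factor: if $\xi,\xi'$ are sections over $U$ and $\iota(\xi)(\omega)=\iota(\xi')(\omega)$ for all sections $\omega$ of $\mathcal T^*Y^{nc}$ over open subsets of $U$, then $\xi=\xi'$. Moreover, over open subsets of $Y\setminus Y_{sing}$ every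 $\mathbb C$-linear derivation of $\mathcal O^{nc}$ satisfies the $C^\infty$ chain rule, so that there $\mathcal T_*Y^{nc}$ is the sheaf of all $\mathbb C$-linear derivations. -/

import Mathlib

open TopologicalSpace Topology Set
open scoped Manifold ContDiff TensorProduct

universe u v w

noncomputable section

namespace AzumayaType

/-! ### Mildly singular manifolds with corners -/

/-- A topological space with a closed discrete set of points declared to be singular. -/
structure SingularSpace (Y : Type u) [TopologicalSpace Y] where
  /-- the singularities -/
  sing : Set Y
  isClosed_sing : IsClosed sing
  discrete_sing : DiscreteTopology sing

/-- The complement of the singularities, as an open set. -/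
def SingularSpace.smoothLocus {Y : Type u} [TopologicalSpace Y] (X : SingularSpace Y) : Opens Y :=
  ⟨X.singᶜ, X.isClosed_sing.isOpen_compl⟩

/-- Two points of `L × [0, 1)` are identified when they are equal or both at height `0`. -/
def coneSetoid (L : Type) : Setoid (L × Ico (0 : ℝ) 1) where
  r a b := a = b ∨ ((a.2 : ℝ) = 0 ∧ (b.2 : ℝ) = 0)
  iseqv :=
    { refl := fun _ => Or.inl rfl
      symm := by
        rintro a b (h | h)
        · exact Or.inl h.symm
        · exact Or.inr ⟨h.2, h.1⟩
      trans := by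
        rintro a b c (rfl | h) (rfl | h')
        · exact Or.inl rfl
        · exact Or.inr h'
        · exact Or.inr h
        · exact Or.inr ⟨h.1, h'.2⟩ }

/-- The open cone over `L`, with the quotient topology. -/
abbrev OpenCone (L : Type) [TopologicalSpace L] : Type := Quotient (coneSetoid L)

/-- A mildly singular `C^∞` `n`-manifold with corners: away from a closed discrete set of
singularities it is a paracompact Hausdorff smooth manifold with corners; each singularity has a
fixed open neighbourhood away from the boundary that is an open cone over a connected closed
topological `(n-1)`-manifold, together with a fixed embedding in a Euclidean space which is smooth
off the apex. -/
structure MildlySingularManifold (n : ℕ) (Y : Type u) [TopologicalSpace Y] extends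
    SingularSpace Y where
  one_le_dim : 1 ≤ n
  charted : ChartedSpace (EuclideanQuadrant n) toSingularSpace.smoothLocus
  isManifold : IsManifold (modelWithCornersEuclideanQuadrant n) ∞ toSingularSpace.smoothLocus
  t2 : T2Space toSingularSpace.smoothLocus
  paracompact : ParacompactSpace toSingularSpace.smoothLocus
  isClosed_boundary : IsClosed ((fun x : toSingularSpace.smoothLocus => (x : Y)) ''
    (modelWithCornersEuclideanQuadrant n).boundary toSingularSpace.smoothLocus)
  /-- the fixed neighbourhood of a singularity -/
  coneNhd : sing → Opens Y
  mem_coneNhd : ∀ p : sing, (p : Y) ∈ coneNhd p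
  coneNhd_sing : ∀ p : sing, ∀ q ∈ coneNhd p, q ∈ sing → q = p
  coneNhd_interior : ∀ p : sing, ∀ x : toSingularSpace.smoothLocus, (x : Y) ∈ coneNhd p →
    (modelWithCornersEuclideanQuadrant n).IsInteriorPoint x
  cone : ∀ p : sing, ∃ (L : Type) (_ : TopologicalSpace L)
    (_ : ChartedSpace (EuclideanSpace ℝ (Fin (n - 1))) L),
    T2Space L ∧ CompactSpace L ∧ ConnectedSpace L ∧
    ∃ e : coneNhd p ≃ₜ OpenCone L, ∀ x : L,
      e ⟨p, mem_coneNhd p⟩ = Quotient.mk (coneSetoid L) (x, ⟨0, by norm_num⟩)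
  /-- the dimension of the ambient space of the chart at a singularity -/
  ambientDim : sing → ℕ
  dim_lt_ambientDim : ∀ p, n < ambientDim p
  /-- the chart at a singularity -/
  emb : ∀ p : sing, coneNhd p → EuclideanSpace ℝ (Fin (ambientDim p))
  isEmbedding_emb : ∀ p, IsEmbedding (emb p)
  smooth_emb : ∀ p : sing, ContMDiffOn (modelWithCornersEuclideanQuadrant n)
    𝓘(ℝ, EuclideanSpace ℝ (Fin (ambientDim p))) ∞
    (fun x : toSingularSpace.smoothLocus =>
      open Classical in if h : (x : Y) ∈ coneNhd p then emb p ⟨x, h⟩ else 0)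
    {x | (x : Y) ∈ coneNhd p}

variable {n : ℕ} {Y : Type u} [TopologicalSpace Y]

instance (M : MildlySingularManifold n Y) : ChartedSpace (EuclideanQuadrant n) M.smoothLocus :=
  M.charted

instance (M : MildlySingularManifold n Y) :
    IsManifold (modelWithCornersEuclideanQuadrant n) ∞ M.smoothLocus :=
  M.isManifold

namespace MildlySingularManifold

variable (M : MildlySingularManifold n Y)

/-- A real function on an open set is smooth when it is smooth on the smooth locus and, near every
singularity, is the restriction of a smooth function on the ambient Euclidean space. -/
def IsSmooth (U : Opens Y) (f : U → ℝ) : Prop :=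
  ContMDiffOn (modelWithCornersEuclideanQuadrant n) 𝓘(ℝ, ℝ) ∞
    (fun x : M.smoothLocus => open Classical in if h : (x : Y) ∈ U then f ⟨x, h⟩ else 0)
    {x | (x : Y) ∈ U} ∧
  ∀ p : M.sing, (p : Y) ∈ U →
    ∃ g : EuclideanSpace ℝ (Fin (M.ambientDim p)) → ℝ, ContDiff ℝ ∞ g ∧
      ∀ᶠ q in 𝓝 (p : Y), ∀ (hU : q ∈ U) (hq : q ∈ M.coneNhd p), f ⟨q, hU⟩ = g (M.emb p ⟨q, hq⟩)

theorem IsSmooth.comp {M : MildlySingularManifold n Y} {U : Opens Y} {s : ℕ}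
    {h : (Fin s → ℝ) → ℝ} (hh : ContDiff ℝ ∞ h) {f : Fin s → U → ℝ}
    (hf : ∀ i, M.IsSmooth U (f i)) : M.IsSmooth U (fun x => h (fun i => f i x)) := by
  classical
  refine ⟨?_, fun p hp => ?_⟩
  · have h1 : ContMDiffOn (modelWithCornersEuclideanQuadrant n) 𝓘(ℝ, Fin s → ℝ) ∞
        (fun (x : M.smoothLocus) i => if h : (x : Y) ∈ U then f i ⟨x, h⟩ else 0)
        {x | (x : Y) ∈ U} := contMDiffOn_pi_space.2 fun i => (hf i).1
    refine (hh.contMDiff.comp_contMDiffOn h1).congr fun x hx => ?_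
    have hx' : (x : Y) ∈ U := hx
    simp [hx']
  · choose g hg hgf using fun i => (hf i).2 p hp
    refine ⟨fun x => h (fun i => g i x), hh.comp (contDiff_pi.2 hg), ?_⟩
    filter_upwards [Filter.eventually_all.2 hgf] with q hq hU hc
    simp only [fun i => hq i hU hc]

theorem IsSmooth.mono {M : MildlySingularManifold n Y} {U V : Opens Y} (hVU : V ≤ U) {f : U → ℝ}
    (hf : M.IsSmooth U f) : M.IsSmooth V (fun x => f ⟨x, hVU x.2⟩) := by
  classical
  refine ⟨?_, fun p hp => ?_⟩
  · refine (hf.1.mono fun x (hx : (x : Y) ∈ V) => hVU hx).congr fun x hx => ?_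
    have hx' : (x : Y) ∈ V := hx
    simp [hx', hVU hx']
  · obtain ⟨g, hg, hgf⟩ := hf.2 p (hVU hp)
    exact ⟨g, hg, hgf.mono fun q hq hU hc => hq (hVU hU) hc⟩

theorem isSmooth_const (U : Opens Y) (c : ℝ) : M.IsSmooth U (fun _ => c) :=
  IsSmooth.comp (s := 0) (h := fun _ => c) contDiff_const (f := fun i => i.elim0)
    (fun i => i.elim0)

theorem IsSmooth.add {M : MildlySingularManifold n Y} {U : Opens Y} {f g : U → ℝ}
    (hf : M.IsSmooth U f) (hg : M.IsSmooth U g) : M.IsSmooth U (fun x => f x + g x) := by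
  have := IsSmooth.comp (h := fun x : Fin 2 → ℝ => x 0 + x 1) (by fun_prop) (f := ![f, g])
    (by intro i; fin_cases i <;> assumption)
  simpa using this

theorem IsSmooth.mul {M : MildlySingularManifold n Y} {U : Opens Y} {f g : U → ℝ}
    (hf : M.IsSmooth U f) (hg : M.IsSmooth U g) : M.IsSmooth U (fun x => f x * g x) := by
  have := IsSmooth.comp (h := fun x : Fin 2 → ℝ => x 0 * x 1) (by fun_prop) (f := ![f, g])
    (by intro i; fin_cases i <;> assumption)
  simpa using this

theorem IsSmooth.sub {M : MildlySingularManifold n Y} {U : Opens Y} {f g : U → ℝ}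
    (hf : M.IsSmooth U f) (hg : M.IsSmooth U g) : M.IsSmooth U (fun x => f x - g x) := by
  have := IsSmooth.comp (h := fun x : Fin 2 → ℝ => x 0 - x 1) (by fun_prop) (f := ![f, g])
    (by intro i; fin_cases i <;> assumption)
  simpa using this

/-- The structure sheaf: smooth real functions. -/
def smooth (U : Opens Y) : Subalgebra ℝ (U → ℝ) where
  carrier := {f | M.IsSmooth U f}
  mul_mem' := IsSmooth.mul
  add_mem' := IsSmooth.add
  algebraMap_mem' c := M.isSmooth_const U c

/-- The complexified structure sheaf: complex functions with smooth real and imaginary parts. -/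
def smoothC (U : Opens Y) : Subalgebra ℂ (U → ℂ) where
  carrier := {f | M.IsSmooth U (fun x => (f x).re) ∧ M.IsSmooth U (fun x => (f x).im)}
  mul_mem' := fun {f g} hf hg =>
    ⟨by simpa using (hf.1.mul hg.1).sub (hf.2.mul hg.2),
      by simpa using (hf.1.mul hg.2).add (hf.2.mul hg.1)⟩
  add_mem' := fun {f g} hf hg =>
    ⟨by simpa using hf.1.add hg.1, by simpa using hf.2.add hg.2⟩
  algebraMap_mem' c := ⟨M.isSmooth_const U c.re, M.isSmooth_const U c.im⟩

/-- A real smooth function as a complex one. -/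
def ofReal {U : Opens Y} (f : M.smooth U) : M.smoothC U :=
  ⟨fun x => (f.1 x : ℂ), by
    refine ⟨f.2, ?_⟩
    simpa using M.isSmooth_const U 0⟩

/-- The function `h(f_1, …, f_s)` for `h ∈ C^∞(ℝ^s)`. -/
def compose {U : Opens Y} {s : ℕ} (h : (Fin s → ℝ) → ℝ) (hh : ContDiff ℝ ∞ h)
    (f : Fin s → M.smooth U) : M.smooth U :=
  ⟨fun x => h (fun i => (f i).1 x), IsSmooth.comp hh fun i => (f i).2⟩

/-- The partial derivative `∂_i h`. -/
def partialDeriv {s : ℕ} (h : (Fin s → ℝ) → ℝ) (i : Fin s) : (Fin s → ℝ) → ℝ :=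
  fun x => fderiv ℝ h x (Pi.single i 1)

theorem contDiff_partialDeriv {s : ℕ} {h : (Fin s → ℝ) → ℝ} (hh : ContDiff ℝ ∞ h) (i : Fin s) :
    ContDiff ℝ ∞ (partialDeriv h i) :=
  (hh.fderiv_right (m := ∞) (by simp)).clm_apply contDiff_const

/-- Restriction of functions. -/
def restrict {U V : Opens Y} (hVU : V ≤ U) : M.smoothC U →ₐ[ℂ] M.smoothC V where
  toFun f := ⟨fun x => f.1 ⟨x, hVU x.2⟩, f.2.1.mono hVU, f.2.2.mono hVU⟩
  map_one' := rfl
  map_mul' _ _ := rfl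
  map_zero' := rfl
  map_add' _ _ := rfl
  commutes' _ := rfl

/-- The ideal of the functions that vanish at a point. -/
def idealAt (U : Opens Y) (q : Y) (hq : q ∈ U) : Ideal (M.smoothC U) where
  carrier := {f | f.1 ⟨q, hq⟩ = 0}
  add_mem' := fun {f g} (hf : f.1 _ = 0) (hg : g.1 _ = 0) => by
    show f.1 _ + g.1 _ = 0
    rw [hf, hg, add_zero]
  zero_mem' := rfl
  smul_mem' := fun c {f} (hf : f.1 _ = 0) => by
    show c.1 _ * f.1 _ = 0
    rw [hf, mul_zero]

end MildlySingularManifold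

/-! ### Sheaves of modules and mildly singular vector bundles -/

/-- A presheaf of modules over the complexified structure sheaf. -/
structure ModPresheaf (M : MildlySingularManifold n Y) where
  /-- the sections over an open set -/
  sec : Opens Y → Type v
  addCommGroup : ∀ U, AddCommGroup (sec U)
  module : ∀ U, Module (M.smoothC U) (sec U)
  /-- restriction -/
  res : ∀ {U V : Opens Y}, V ≤ U → sec U →+ sec V
  res_smul : ∀ {U V : Opens Y} (h : V ≤ U) (f : M.smoothC U) (s : sec U),
    res h (f • s) = M.restrict h f • res h s
  res_refl : ∀ {U : Opens Y} (s : sec U), res le_rfl s = s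
  res_res : ∀ {U V W : Opens Y} (h : V ≤ U) (h' : W ≤ V) (s : sec U),
    res h' (res h s) = res (h'.trans h) s

instance {M : MildlySingularManifold n Y} (F : ModPresheaf.{u, v} M) (U : Opens Y) :
    AddCommGroup (F.sec U) := F.addCommGroup U

instance {M : MildlySingularManifold n Y} (F : ModPresheaf.{u, v} M) (U : Opens Y) :
    Module (M.smoothC U) (F.sec U) := F.module U

namespace ModPresheaf

variable {M : MildlySingularManifold n Y} (F G : ModPresheaf.{u, v} M)

/-- The sheaf condition. -/
def IsSheaf : Prop :=
  ∀ (ι : Type u) (U : ι → Opens Y) (s : ∀ i, F.sec (U i)),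
    (∀ i j, F.res (inf_le_left : U i ⊓ U j ≤ U i) (s i) =
      F.res (inf_le_right : U i ⊓ U j ≤ U j) (s j)) →
    ∃! t : F.sec (⨆ i, U i), ∀ i, F.res (le_iSup U i) t = s i

/-- The section `s` is zero in the fibre at `q`, i.e. its germ lies in `𝔪_q F_q`. -/
def VanishAt {U : Opens Y} (s : F.sec U) (q : Y) : Prop :=
  ∃ (V : Opens Y) (hV : V ≤ U) (hq : q ∈ V),
    F.res hV s ∈ M.idealAt V q hq • (⊤ : Submodule (M.smoothC V) (F.sec V))

variable {F} in
theorem res_mem_smul_top {U V : Opens Y} (h : V ≤ U) {q : Y} (hq : q ∈ V) {s : F.sec U}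
    (hs : s ∈ M.idealAt U q (h hq) • (⊤ : Submodule (M.smoothC U) (F.sec U))) :
    F.res h s ∈ M.idealAt V q hq • (⊤ : Submodule (M.smoothC V) (F.sec V)) := by
  induction hs using Submodule.smul_induction_on' with
  | smul f hf x hx =>
    rw [F.res_smul]
    exact Submodule.smul_mem_smul hf trivial
  | add x hx y hy ihx ihy => rw [map_add]; exact add_mem ihx ihy

variable {F} in
theorem VanishAt.add {U : Opens Y} {s t : F.sec U} {q : Y} (hs : F.VanishAt s q)
    (ht : F.VanishAt t q) : F.VanishAt (s + t) q := by
  obtain ⟨V, hV, hq, h⟩ := hs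
  obtain ⟨W, hW, hq', h'⟩ := ht
  refine ⟨V ⊓ W, inf_le_left.trans hV, ⟨hq, hq'⟩, ?_⟩
  rw [map_add]
  refine add_mem ?_ ?_
  · rw [← F.res_res hV inf_le_left]; exact res_mem_smul_top _ _ h
  · rw [← F.res_res hW inf_le_right]; exact res_mem_smul_top _ _ h'

variable {F} in
theorem VanishAt.smul {U : Opens Y} {s : F.sec U} {q : Y} (f : M.smoothC U)
    (hs : F.VanishAt s q) : F.VanishAt (f • s) q := by
  obtain ⟨V, hV, hq, h⟩ := hs
  exact ⟨V, hV, hq, by rw [F.res_smul]; exact Submodule.smul_mem _ _ h⟩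

variable {F} in
theorem VanishAt.res {U V : Opens Y} (hVU : V ≤ U) {s : F.sec U} {q : Y} (hq : q ∈ V)
    (hs : F.VanishAt s q) : F.VanishAt (F.res hVU s) q := by
  obtain ⟨W, hW, hqW, h⟩ := hs
  refine ⟨V ⊓ W, inf_le_left, ⟨hq, hqW⟩, ?_⟩
  rw [F.res_res, ← F.res_res hW inf_le_right]
  exact res_mem_smul_top _ _ h

variable {F} in
theorem vanishAt_of_mem {U : Opens Y} {s : F.sec U} {q : Y} (hq : q ∈ U)
    (h : s ∈ M.idealAt U q hq • (⊤ : Submodule (M.smoothC U) (F.sec U))) : F.VanishAt s q :=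
  ⟨U, le_rfl, hq, by rwa [F.res_refl]⟩

/-- The sections over `U` that are zero in the fibre at `q ∈ U`. -/
def vanishing (U : Opens Y) (q : Y) (hq : q ∈ U) : Submodule (M.smoothC U) (F.sec U) where
  carrier := {s | F.VanishAt s q}
  add_mem' := VanishAt.add
  zero_mem' := vanishAt_of_mem hq (zero_mem _)
  smul_mem' f _ := VanishAt.smul f

/-- The fibre at `q`, for an open set `U` that contains `q`: sections over `U` modulo those that are
zero in the fibre. -/
def Fibre (U : Opens Y) (q : Y) (hq : q ∈ U) : Type v := F.sec U ⧸ F.vanishing U q hq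

instance (U : Opens Y) (q : Y) (hq : q ∈ U) : AddCommGroup (F.Fibre U q hq) :=
  inferInstanceAs (AddCommGroup (F.sec U ⧸ F.vanishing U q hq))

instance (U : Opens Y) (q : Y) (hq : q ∈ U) : Module ℂ (F.Fibre U q hq) :=
  Module.compHom (F.sec U ⧸ F.vanishing U q hq) (algebraMap ℂ (M.smoothC U))

/-- The value of a section in the fibre. -/
def toFibre (U : Opens Y) (q : Y) (hq : q ∈ U) : F.sec U →+ F.Fibre U q hq :=
  (F.vanishing U q hq).mkQ.toAddMonoidHom

theorem toFibre_const_smul (U : Opens Y) (q : Y) (hq : q ∈ U) (c : ℂ) (s : F.sec U) :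
    F.toFibre U q hq (algebraMap ℂ (M.smoothC U) c • s) = c • F.toFibre U q hq s := rfl

/-- `F` is a mildly singular vector bundle over `W`: locally free of finite rank at the smooth
points of `W` and locally finitely generated at the singular ones. -/
def IsMildlySingularBundle (W : Opens Y) : Prop :=
  (∀ q ∈ W, q ∉ M.sing → ∃ (N : Opens Y) (_ : q ∈ N) (_ : N ≤ W) (r : ℕ) (b : Fin r → F.sec N),
    ∀ (V : Opens Y) (hV : V ≤ N) (s : F.sec V),
      ∃! c : Fin r → M.smoothC V, s = ∑ k, c k • F.res hV (b k)) ∧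
  (∀ p ∈ W, p ∈ M.sing → ∃ (N : Opens Y) (_ : p ∈ N) (_ : N ≤ W) (r : ℕ) (b : Fin r → F.sec N),
    ∀ (V : Opens Y) (hV : V ≤ N) (s : F.sec V), ∀ q ∈ V,
      ∃ (V' : Opens Y) (_ : q ∈ V') (h : V' ≤ V) (c : Fin r → M.smoothC V'),
        F.res h s = ∑ k, c k • F.res (h.trans hV) (b k))

/-- A homomorphism of the restrictions of two (pre)sheaves of modules to an open set `N`. -/
structure HomOn (N : Opens Y) where
  /-- the map on sections -/
  map : ∀ V : Opens Y, V ≤ N → F.sec V →ₗ[M.smoothC V] G.sec V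
  map_res : ∀ {V W : Opens Y} (h : W ≤ V) (hV : V ≤ N) (s : F.sec V),
    G.res h (map V hV s) = map W (h.trans hV) (F.res h s)

variable {F G} in
/-- The homomorphism is injective on the fibres at the points of `A`. -/
def HomOn.FibrewiseInjective {N : Opens Y} (φ : HomOn F G N) (A : Set Y) : Prop :=
  ∀ (V : Opens Y) (hV : V ≤ N) (s : F.sec V), ∀ q ∈ V, q ∈ A →
    G.VanishAt (φ.map V hV s) q → F.VanishAt s q

variable {F G} in
theorem VanishAt.hom {N : Opens Y} (φ : HomOn F G N) {V : Opens Y} (hV : V ≤ N) {s : F.sec V}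
    {q : Y} (hs : F.VanishAt s q) : G.VanishAt (φ.map V hV s) q := by
  obtain ⟨W, hW, hq, h⟩ := hs
  refine ⟨W, hW, hq, ?_⟩
  rw [φ.map_res]
  generalize F.res hW s = y at h
  induction h using Submodule.smul_induction_on' with
  | smul f hf x hx =>
    rw [map_smul]
    exact Submodule.smul_mem_smul hf trivial
  | add x hx y hy ihx ihy => rw [map_add]; exact add_mem ihx ihy

end ModPresheaf

/-! ### Regular partitions -/

/-- Near the smooth point `p` the sets `block i` are the `2^k` coordinate quadrants, in a chart,
cut out by `k` coordinates that are not boundary coordinates at `p`; distinct quadrants belong to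
distinct `i`, and the other `block i` do not meet the chart domain. -/
def IsQuadrantPoint (M : MildlySingularManifold n Y) {I : Type w} (block : I → Set Y) (k : ℕ)
    (p : M.smoothLocus) : Prop :=
  ∃ φ ∈ IsManifold.maximalAtlas (modelWithCornersEuclideanQuadrant n) ∞ M.smoothLocus,
    p ∈ φ.source ∧
    ∃ (a : Fin k ↪ Fin n) (b : (Fin k → Bool) ↪ I), (∀ c, 0 < (φ p).1 (a c)) ∧
      ∀ q ∈ φ.source, ∀ i, (q : Y) ∈ block i ↔ ∃ ε, b ε = i ∧
        ∀ c, if ε c then (φ p).1 (a c) ≤ (φ q).1 (a c) else (φ q).1 (a c) ≤ (φ p).1 (a c)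

/-- A regular partition: a decomposition in connected blocks, locally diffeomorphic to the
decomposition in coordinate quadrants, with every singularity in the interior of a block. -/
structure RegularPartition (M : MildlySingularManifold n Y) where
  /-- the index set -/
  I : Type w
  /-- the blocks -/
  block : I → Set Y
  connected : ∀ i, IsConnected (block i)
  quadrant : ∀ p : M.smoothLocus, ∃ k, IsQuadrantPoint M block k p
  sing_interior : ∀ p ∈ M.sing, ∃ i, block i ∈ 𝓝 p ∧ ∀ j, j ≠ i → (block j)ᶜ ∈ 𝓝 p

namespace RegularPartition

variable {M : MildlySingularManifold n Y} (P : RegularPartition.{u, w} M)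

/-- The codimension-`k` stratum, for `k ≥ 1`. -/
def stratum (k : ℕ) : Set Y :=
  {q | ∃ h : q ∈ M.smoothLocus, IsQuadrantPoint M P.block k ⟨q, h⟩}

/-- The closed codimension-`k` facets: closures of connected components of the stratum. -/
def IsFacet (k : ℕ) (Z : Set Y) : Prop :=
  ∃ q ∈ P.stratum k, Z = closure (connectedComponentIn (P.stratum k) q)

end RegularPartition

/-! ### Bundle settlements -/

/-- Bundle blocks (restrictions to the blocks of bundles on open neighbourhoods) and clutching maps
between them along facets. A clutching map along a facet is the restriction to the facet of a
bundle embedding defined on an open neighbourhood of it. -/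
structure GluingData {M : MildlySingularManifold n Y} (P : RegularPartition.{u, w} M) where
  /-- the domain of the extended bundle block -/
  dom : P.I → Opens Y
  block_subset_dom : ∀ i, P.block i ⊆ dom i
  /-- the extended bundle block (only its restriction to `dom i` matters) -/
  ext : P.I → ModPresheaf.{u, v} M
  isSheaf : ∀ i, (ext i).IsSheaf
  isBundle : ∀ i, (ext i).IsMildlySingularBundle (dom i)
  /-- the arrows of the clutching quivers -/
  Arrow : Type w
  /-- the source block -/
  src : Arrow → P.I
  /-- the target block -/
  tgt : Arrow → P.I
  src_ne_tgt : ∀ e, src e ≠ tgt e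
  /-- the codimension of the facet of an arrow -/
  codim : Arrow → ℕ
  one_le_codim : ∀ e, 1 ≤ codim e
  /-- the facet along which the arrow is assigned -/
  facet : Arrow → Set Y
  isFacet : ∀ e, P.IsFacet (codim e) (facet e)
  facet_subset : ∀ e, facet e ⊆ P.block (src e) ∩ P.block (tgt e)
  /-- the neighbourhood of the facet where the extended clutching map is defined -/
  nhd : Arrow → Opens Y
  facet_subset_nhd : ∀ e, facet e ⊆ nhd e
  nhd_le : ∀ e, nhd e ≤ dom (src e) ⊓ dom (tgt e) ⊓ M.smoothLocus
  /-- the extended clutching map -/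
  clutch : ∀ e, ModPresheaf.HomOn (ext (src e)) (ext (tgt e)) (nhd e)
  clutch_embedding : ∀ e, (clutch e).FibrewiseInjective (nhd e)

namespace GluingData

variable {M : MildlySingularManifold n Y} {P : RegularPartition.{u, w} M}
  (𝔖 : GluingData.{u, v, w} P)

/-- `v` is a terminal vertex of the quiver at `p` with the arrows in `A`: the vertices are the
blocks through `p`, the arrows those whose facet passes through `p`, and every vertex is connected
to `v` by a path. -/
def IsTerminal (A : Set 𝔖.Arrow) (p : Y) (v : P.I) : Prop :=
  p ∈ P.block v ∧ ∀ i, p ∈ P.block i →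
    Relation.ReflTransGen (fun j k => ∃ e ∈ A, p ∈ 𝔖.facet e ∧ 𝔖.src e = j ∧ 𝔖.tgt e = k) i v

/-- One application of an (extended) clutching map whose facet passes through `q`. -/
inductive Step (q : Y) (V : Opens Y) :
    (Σ i, (𝔖.ext i).sec V) → (Σ i, (𝔖.ext i).sec V) → Prop
  | mk (e : 𝔖.Arrow) (hq : q ∈ 𝔖.facet e) (hV : V ≤ 𝔖.nhd e) (s : (𝔖.ext (𝔖.src e)).sec V) :
      Step q V ⟨𝔖.src e, s⟩ ⟨𝔖.tgt e, (𝔖.clutch e).map V hV s⟩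

end GluingData

/-- A mildly singular `C^∞` complex vector bundle settlement. -/
structure BundleSettlement {M : MildlySingularManifold n Y} (P : RegularPartition.{u, w} M) extends
    GluingData.{u, v, w} P where
  /-- along a wall exactly one clutching map, between the two blocks, is assigned -/
  wall : ∀ Z, P.IsFacet 1 Z → ∃! e, codim e = 1 ∧ facet e = Z
  /-- the clutching quivers are saturated -/
  saturated : ∀ p, ∃ v, toGluingData.IsTerminal univ p v
  /-- in higher codimension, arrows are added only where those of lower codimension do not yet
  give a saturated quiver -/
  added : ∀ e, 2 ≤ codim e → ∀ p ∈ facet e, p ∈ P.stratum (codim e) →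
    ¬ ∃ v, toGluingData.IsTerminal {e' | codim e' < codim e} p v
  /-- over each facet the composite of the clutching maps along a path depends only on the ends of
  the path, and is the identity when the path is a loop -/
  consistent : ∀ (q : Y) (V : Opens Y), q ∈ V → ∀ x j (t t' : (ext j).sec V),
    Relation.ReflTransGen (toGluingData.Step q V) x ⟨j, t⟩ →
    Relation.ReflTransGen (toGluingData.Step q V) x ⟨j, t'⟩ → (ext j).VanishAt (t - t') q

/-- A tame bundle settlement, with its bundle atlas from local distinguished blocks: on a
neighbourhood of each point `p` the clutching maps extend to an embedding of the settlement in the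
extended bundle block of the distinguished block at `p`. -/
structure TameSettlement {M : MildlySingularManifold n Y} (P : RegularPartition.{u, w} M) extends
    BundleSettlement.{u, v, w} P where
  /-- the distinguished block at a point -/
  dist : Y → P.I
  dist_terminal : ∀ p, toGluingData.IsTerminal univ p (dist p)
  /-- the domain of the bundle chart at a point -/
  chartNhd : Y → Opens Y
  mem_chartNhd : ∀ p, p ∈ chartNhd p
  chartNhd_le_dom : ∀ p, chartNhd p ≤ dom (dist p)
  chartNhd_sing : ∀ p, ∀ q ∈ chartNhd p, q ∈ M.sing → q = p
  chartNhd_block : ∀ p, ∀ q ∈ chartNhd p, ∀ i, q ∈ P.block i → p ∈ P.block i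
  /-- the embedding of a bundle block (only its restriction to `block i` matters, and only when
  `p ∈ block i`) -/
  chart : ∀ p i, ModPresheaf.HomOn (ext i) (ext (dist p)) (chartNhd p ⊓ dom i)
  chart_dist : ∀ p V (hV : V ≤ chartNhd p ⊓ dom (dist p)) (s : (ext (dist p)).sec V),
    (chart p (dist p)).map V hV s = s
  chart_embedding : ∀ p i, p ∈ P.block i →
    (chart p i).FibrewiseInjective (P.block i ∩ M.smoothLocus)
  chart_clutch : ∀ p e (V : Opens Y) (hV : V ≤ chartNhd p ⊓ nhd e) (s : (ext (src e)).sec V),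
    ∀ q ∈ V, q ∈ facet e → (ext (dist p)).VanishAt
      ((chart p (tgt e)).map V
          (le_inf (hV.trans inf_le_left)
            (hV.trans (inf_le_right.trans
              ((nhd_le e).trans (inf_le_left.trans inf_le_right)))))
          ((clutch e).map V (hV.trans inf_le_right) s) -
        (chart p (src e)).map V
          (le_inf (hV.trans inf_le_left)
            (hV.trans (inf_le_right.trans
              ((nhd_le e).trans (inf_le_left.trans inf_le_left))))) s) q

namespace TameSettlement

variable {M : MildlySingularManifold n Y} {P : RegularPartition.{u, w} M}
  (𝔖 : TameSettlement.{u, v, w} P)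

/-- The fibre of the settlement at a smooth point: that of the distinguished block. -/
abbrev Fib (q : Y) : Type v :=
  (𝔖.ext (𝔖.dist q)).Fibre (𝔖.chartNhd q) q (𝔖.mem_chartNhd q)

/-- Families consisting of an element of the fibre for each smooth point of `V` and, for each
singularity `p` in `V`, a section over `V ⊓ chartNhd p` of the bundle around `p`. -/
def PreSec (V : Opens Y) : Type (max u v) :=
  (∀ q : {q : Y // q ∈ V ∧ q ∉ M.sing}, 𝔖.Fib q.1) ×
  (∀ p : {p : Y // p ∈ V ∧ p ∈ M.sing}, (𝔖.ext (𝔖.dist p.1)).sec (V ⊓ 𝔖.chartNhd p.1))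

instance (V : Opens Y) : AddCommGroup (𝔖.PreSec V) :=
  inferInstanceAs (AddCommGroup (_ × _))

instance (V : Opens Y) : SMul (M.smoothC V) (𝔖.PreSec V) where
  smul f x := (fun q => f.1 ⟨q.1, q.2.1⟩ • x.1 q,
    fun p => M.restrict (inf_le_left : V ⊓ 𝔖.chartNhd p.1 ≤ V) f • x.2 p)

section

variable {𝔖}

theorem PreSec.ext {V : Opens Y} {x y : 𝔖.PreSec V} (h1 : ∀ q, x.1 q = y.1 q)
    (h2 : ∀ p, x.2 p = y.2 p) : x = y :=
  Prod.ext (funext h1) (funext h2)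

theorem PreSec.smul_fst {V : Opens Y} (f : M.smoothC V) (x : 𝔖.PreSec V) (q) :
    (f • x).1 q = f.1 ⟨q.1, q.2.1⟩ • x.1 q := rfl

theorem PreSec.smul_snd {V : Opens Y} (f : M.smoothC V) (x : 𝔖.PreSec V) (p) :
    (f • x).2 p = M.restrict (inf_le_left : V ⊓ 𝔖.chartNhd p.1 ≤ V) f • x.2 p := rfl

theorem PreSec.add_fst {V : Opens Y} (x y : 𝔖.PreSec V) (q) :
    (x + y).1 q = x.1 q + y.1 q := rfl

theorem PreSec.add_snd {V : Opens Y} (x y : 𝔖.PreSec V) (p) :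
    (x + y).2 p = x.2 p + y.2 p := rfl

theorem PreSec.zero_fst {V : Opens Y} (q) : (0 : 𝔖.PreSec V).1 q = 0 := rfl

theorem PreSec.zero_snd {V : Opens Y} (p) : (0 : 𝔖.PreSec V).2 p = 0 := rfl

end

instance (V : Opens Y) : Module (M.smoothC V) (𝔖.PreSec V) where
  one_smul x := PreSec.ext
    (fun q => by rw [PreSec.smul_fst]; exact one_smul ℂ _)
    (fun p => by rw [PreSec.smul_snd, map_one, one_smul])
  mul_smul f g x := PreSec.ext
    (fun q => by simp only [PreSec.smul_fst]; exact mul_smul (f.1 _) (g.1 _) _)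
    (fun p => by simp only [PreSec.smul_snd, map_mul, mul_smul])
  smul_zero f := PreSec.ext
    (fun q => by rw [PreSec.smul_fst, PreSec.zero_fst, smul_zero])
    (fun p => by rw [PreSec.smul_snd, PreSec.zero_snd, smul_zero])
  smul_add f x y := PreSec.ext
    (fun q => by simp only [PreSec.smul_fst, PreSec.add_fst, smul_add])
    (fun p => by simp only [PreSec.smul_snd, PreSec.add_snd, smul_add])
  add_smul f g x := PreSec.ext
    (fun q => by
      simp only [PreSec.smul_fst, PreSec.add_fst]; exact add_smul (f.1 _) (g.1 _) _)
    (fun p => by simp only [PreSec.smul_snd, PreSec.add_snd, map_add, add_smul])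
  zero_smul x := PreSec.ext
    (fun q => by rw [PreSec.smul_fst, PreSec.zero_fst]; exact zero_smul ℂ _)
    (fun p => by rw [PreSec.smul_snd, PreSec.zero_snd, map_zero, zero_smul])

/-- On `N`, the values `x` are carried by the bundle chart at `p` to those of the section `t` of the
extended bundle block at `p`. -/
def InChart {V : Opens Y} (x : 𝔖.PreSec V) (p : Y) (N : Opens Y) (hN : N ≤ V ⊓ 𝔖.chartNhd p)
    (t : (𝔖.ext (𝔖.dist p)).sec N) : Prop :=
  ∀ (q : Y) (hq : q ∈ N) (hs : q ∉ M.sing),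
    ∃ s : (𝔖.ext (𝔖.dist q)).sec (𝔖.chartNhd q),
      (𝔖.ext (𝔖.dist q)).toFibre _ q (𝔖.mem_chartNhd q) s = x.1 ⟨q, (hN hq).1, hs⟩ ∧
      (𝔖.ext (𝔖.dist p)).VanishAt
        ((𝔖.chart p (𝔖.dist q)).map (N ⊓ 𝔖.chartNhd q)
            (le_inf (inf_le_left.trans (hN.trans inf_le_right))
              (inf_le_right.trans (𝔖.chartNhd_le_dom q)))
            ((𝔖.ext (𝔖.dist q)).res inf_le_right s) -
          (𝔖.ext (𝔖.dist p)).res inf_le_left t) q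

/-- The smooth sections over `V`: at every smooth point the family is, in the bundle chart there,
given by a section of the extended bundle block; around a singularity it is given by the section
that is part of the family. -/
def IsSection {V : Opens Y} (x : 𝔖.PreSec V) : Prop :=
  (∀ p ∈ V, p ∉ M.sing → ∃ (N : Opens Y) (hN : N ≤ V ⊓ 𝔖.chartNhd p) (_ : p ∈ N)
    (t : (𝔖.ext (𝔖.dist p)).sec N), 𝔖.InChart x p N hN t) ∧
  (∀ p : {p : Y // p ∈ V ∧ p ∈ M.sing},
    𝔖.InChart x p.1 (V ⊓ 𝔖.chartNhd p.1) le_rfl (x.2 p))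

variable {𝔖}

theorem InChart.zero {V : Opens Y} {p : Y} {N : Opens Y} (hN : N ≤ V ⊓ 𝔖.chartNhd p) :
    𝔖.InChart (0 : 𝔖.PreSec V) p N hN 0 := fun q hq hs =>
  ⟨0, map_zero _, ModPresheaf.vanishAt_of_mem ⟨hq, 𝔖.mem_chartNhd q⟩ (by simp)⟩

theorem InChart.add {V : Opens Y} {x y : 𝔖.PreSec V} {p : Y} {N : Opens Y}
    {hN : N ≤ V ⊓ 𝔖.chartNhd p} {t t' : (𝔖.ext (𝔖.dist p)).sec N}
    (h : 𝔖.InChart x p N hN t) (h' : 𝔖.InChart y p N hN t') :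
    𝔖.InChart (x + y) p N hN (t + t') := by
  intro q hq hs
  obtain ⟨s, h1, h2⟩ := h q hq hs
  obtain ⟨s', h1', h2'⟩ := h' q hq hs
  refine ⟨s + s', ?_, ?_⟩
  · rw [map_add, h1, h1']; rfl
  · have := h2.add h2'
    rw [sub_add_sub_comm] at this
    simpa only [map_add] using this

theorem InChart.smul {V : Opens Y} {x : 𝔖.PreSec V} {p : Y} {N : Opens Y}
    {hN : N ≤ V ⊓ 𝔖.chartNhd p} {t : (𝔖.ext (𝔖.dist p)).sec N}
    (h : 𝔖.InChart x p N hN t) (f : M.smoothC V) :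
    𝔖.InChart (f • x) p N hN (M.restrict (hN.trans inf_le_left) f • t) := by
  intro q hq hs
  obtain ⟨s, h1, h2⟩ := h q hq hs
  refine ⟨algebraMap ℂ (M.smoothC (𝔖.chartNhd q)) (f.1 ⟨q, (hN hq).1⟩) • s, ?_, ?_⟩
  · rw [ModPresheaf.toFibre_const_smul, h1]; rfl
  · have hq' : q ∈ N ⊓ 𝔖.chartNhd q := ⟨hq, 𝔖.mem_chartNhd q⟩
    have h3 := h2.smul (algebraMap ℂ (M.smoothC (N ⊓ 𝔖.chartNhd q)) (f.1 ⟨q, (hN hq).1⟩))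
    have h4 : (𝔖.ext (𝔖.dist p)).VanishAt
        ((algebraMap ℂ (M.smoothC (N ⊓ 𝔖.chartNhd q)) (f.1 ⟨q, (hN hq).1⟩) -
          M.restrict inf_le_left (M.restrict (hN.trans inf_le_left) f)) •
            (𝔖.ext (𝔖.dist p)).res inf_le_left t) q :=
      ModPresheaf.vanishAt_of_mem hq' (Submodule.smul_mem_smul (sub_self _) trivial)
    have h5 := h3.add h4
    convert h5 using 1
    rw [ModPresheaf.res_smul, ModPresheaf.res_smul, AlgHom.commutes, map_smul, smul_sub, sub_smul]
    abel

theorem InChart.mono {V W : Opens Y} (hWV : W ≤ V) {x : 𝔖.PreSec V} {y : 𝔖.PreSec W}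
    (hxy : ∀ q : {q : Y // q ∈ W ∧ q ∉ M.sing}, y.1 q = x.1 ⟨q.1, hWV q.2.1, q.2.2⟩) {p : Y}
    {N N' : Opens Y} {hN : N ≤ V ⊓ 𝔖.chartNhd p} (hN' : N' ≤ W ⊓ 𝔖.chartNhd p) (hNN : N' ≤ N)
    {t : (𝔖.ext (𝔖.dist p)).sec N} (h : 𝔖.InChart x p N hN t) :
    𝔖.InChart y p N' hN' ((𝔖.ext (𝔖.dist p)).res hNN t) := by
  intro q hq hs
  obtain ⟨s, h1, h2⟩ := h q (hNN hq) hs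
  refine ⟨s, h1.trans (hxy ⟨q, (hN' hq).1, hs⟩).symm, ?_⟩
  have h3 := h2.res (inf_le_inf_right (𝔖.chartNhd q) hNN) ⟨hq, 𝔖.mem_chartNhd q⟩
  rw [map_sub, ModPresheaf.HomOn.map_res, ModPresheaf.res_res, ModPresheaf.res_res] at h3
  rw [ModPresheaf.res_res]
  exact h3

variable (𝔖)

/-- The module of smooth sections over `V`. -/
def secModule (V : Opens Y) : Submodule (M.smoothC V) (𝔖.PreSec V) where
  carrier := {x | 𝔖.IsSection x}
  zero_mem' := ⟨fun p hp _ => ⟨V ⊓ 𝔖.chartNhd p, le_rfl, ⟨hp, 𝔖.mem_chartNhd p⟩, 0,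
    InChart.zero _⟩, fun _ => InChart.zero _⟩
  add_mem' := fun {x y} hx hy => ⟨fun p hp hs => by
    obtain ⟨N, hN, hpN, t, h⟩ := hx.1 p hp hs
    obtain ⟨N', hN', hpN', t', h'⟩ := hy.1 p hp hs
    exact ⟨N ⊓ N', inf_le_left.trans hN, ⟨hpN, hpN'⟩, _,
      (h.mono le_rfl (fun _ => rfl) (inf_le_left.trans hN) inf_le_left).add
        (h'.mono le_rfl (fun _ => rfl) (inf_le_left.trans hN) inf_le_right)⟩,
    fun p => (hx.2 p).add (hy.2 p)⟩
  smul_mem' := fun f x hx => ⟨fun p hp hs => by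
    obtain ⟨N, hN, hpN, t, h⟩ := hx.1 p hp hs
    exact ⟨N, hN, hpN, _, h.smul f⟩, fun p => (hx.2 p).smul f⟩

/-- The sheaf of smooth sections of a tame bundle settlement. -/
def sections : ModPresheaf.{u, max u v} M where
  sec V := 𝔖.secModule V
  addCommGroup V := inferInstance
  module V := inferInstance
  res := fun {U V} h =>
    { toFun := fun x => ⟨(fun q => x.1.1 ⟨q.1, h q.2.1, q.2.2⟩,
        fun p => (𝔖.ext (𝔖.dist p.1)).res (inf_le_inf_right _ h) (x.1.2 ⟨p.1, h p.2.1, p.2.2⟩)),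
        fun p hp hs => by
          obtain ⟨N, hN, hpN, t, ht⟩ := x.2.1 p (h hp) hs
          exact ⟨N ⊓ V, le_inf inf_le_right (inf_le_left.trans (hN.trans inf_le_right)),
            ⟨hpN, hp⟩, _, ht.mono h (fun _ => rfl) _ inf_le_left⟩,
        fun p => (x.2.2 ⟨p.1, h p.2.1, p.2.2⟩).mono h (fun _ => rfl) _ (inf_le_inf_right _ h)⟩
      map_zero' := Subtype.ext (Prod.ext rfl (funext fun p => map_zero _))
      map_add' := fun x y => Subtype.ext (Prod.ext rfl (funext fun p => map_add _ _ _)) }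
  res_smul h f x := Subtype.ext (Prod.ext rfl (funext fun p =>
    (𝔖.ext (𝔖.dist p.1)).res_smul (inf_le_inf_right _ h)
      (M.restrict (inf_le_left : _ ⊓ 𝔖.chartNhd p.1 ≤ _) f) _))
  res_refl x := Subtype.ext (Prod.ext rfl (funext fun p => (𝔖.ext (𝔖.dist p.1)).res_refl _))
  res_res h h' x := Subtype.ext (Prod.ext rfl (funext fun p =>
    (𝔖.ext (𝔖.dist p.1)).res_res _ _ _))

end TameSettlement

/-! ### The module of differentials of a ring -/

section Differentials

variable (R : Type w) [Ring R]

/-- Bimodules over `R` are modules over `R ⊗ Rᵐᵒᵖ`. -/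
abbrev Env : Type w := R ⊗[ℤ] Rᵐᵒᵖ

variable {R} in
/-- Left multiplication in a bimodule. -/
def lmul {X : Type*} [AddCommGroup X] [Module (Env R) X] (a : R) (x : X) : X :=
  (a ⊗ₜ[ℤ] (1 : Rᵐᵒᵖ) : Env R) • x

variable {R} in
/-- Right multiplication in a bimodule. -/
def rmul {X : Type*} [AddCommGroup X] [Module (Env R) X] (x : X) (a : R) : X :=
  ((1 : R) ⊗ₜ[ℤ] MulOpposite.op a : Env R) • x

section

variable {R}
variable {X : Type*} [AddCommGroup X] [Module (Env R) X]

theorem lmul_add (a : R) (x y : X) : lmul a (x + y) = lmul a x + lmul a y := smul_add _ _ _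

theorem add_lmul (a b : R) (x : X) : lmul (a + b) x = lmul a x + lmul b x := by
  simp only [lmul, TensorProduct.add_tmul, add_smul]

theorem lmul_zero (a : R) : lmul a (0 : X) = 0 := smul_zero _

theorem zero_lmul (x : X) : lmul (0 : R) x = 0 := by
  rw [lmul, TensorProduct.zero_tmul]; exact zero_smul (Env R) x

theorem one_lmul (x : X) : lmul (1 : R) x = x := one_smul (Env R) x

theorem mul_lmul (a b : R) (x : X) : lmul (a * b) x = lmul a (lmul b x) := by
  simp [lmul, smul_smul]

theorem rmul_add (x : X) (a b : R) : rmul x (a + b) = rmul x a + rmul x b := by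
  simp only [rmul, MulOpposite.op_add, TensorProduct.tmul_add, add_smul]

theorem add_rmul (x y : X) (a : R) : rmul (x + y) a = rmul x a + rmul y a := smul_add _ _ _

theorem rmul_zero (x : X) : rmul x (0 : R) = 0 := by
  rw [rmul, MulOpposite.op_zero, TensorProduct.tmul_zero]; exact zero_smul (Env R) x

theorem zero_rmul (a : R) : rmul (0 : X) a = 0 := smul_zero _

theorem rmul_one (x : X) : rmul x (1 : R) = x := one_smul (Env R) x

theorem rmul_mul (x : X) (a b : R) : rmul x (a * b) = rmul (rmul x a) b := by
  simp [rmul, smul_smul]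

theorem lmul_rmul (a b : R) (x : X) : lmul a (rmul x b) = rmul (lmul a x) b := by
  simp [lmul, rmul, smul_smul]

end

variable {R} in
/-- The generator `d(r)` of the free bimodule on the symbols `d(r)`, `r ∈ R`. -/
def symb (r : R) : R →₀ Env R := Finsupp.single r 1

variable [Algebra ℂ R]

variable {R} in
/-- The relations among the differentials: `ℂ`-linearity, the Leibniz rule, commutativity with the
centre, and the chain rule for the members of `chain`; a member `(y, [(a_1, r_1), …, (a_s, r_s)])`
of `chain` stands for `y = h(r_1, …, r_s)`, `a_i = ∂_i h(r_1, …, r_s)`. -/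
inductive DiffRel (chain : Set (R × List (R × R))) : (R →₀ Env R) → Prop
  | linear_left (a b : ℂ) (r s : R) : DiffRel chain
      (symb (a • r + b • s) -
        (lmul (algebraMap ℂ R a) (symb r) + lmul (algebraMap ℂ R b) (symb s)))
  | linear_right (a b : ℂ) (r s : R) : DiffRel chain
      (symb (a • r + b • s) -
        (rmul (symb r) (algebraMap ℂ R a) + rmul (symb s) (algebraMap ℂ R b)))
  | leibniz (r s : R) : DiffRel chain (symb (r * s) - (rmul (symb r) s + lmul r (symb s)))
  | center (r : R) (z : R) (hz : z ∈ Subring.center R) : DiffRel chain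
      (rmul (symb r) z - lmul z (symb r))
  | chain (y : R) (l : List (R × R)) (hl : (y, l) ∈ chain) : DiffRel chain
      (symb y - (l.map fun ar => lmul ar.1 (symb ar.2)).sum)

/-- The module of differentials of `R` over `ℂ`, as an `R`-bimodule. -/
def Differentials (chain : Set (R × List (R × R))) : Type w :=
  (R →₀ Env R) ⧸ Submodule.span (Env R) {x | DiffRel chain x}

instance (chain : Set (R × List (R × R))) : AddCommGroup (Differentials R chain) :=
  inferInstanceAs (AddCommGroup ((R →₀ Env R) ⧸ Submodule.span (Env R) {x | DiffRel chain x}))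

instance (chain : Set (R × List (R × R))) : Module (Env R) (Differentials R chain) :=
  inferInstanceAs (Module (Env R) ((R →₀ Env R) ⧸ Submodule.span (Env R) {x | DiffRel chain x}))

variable {R} in
/-- The differential `dr`. -/
def Differentials.d {chain : Set (R × List (R × R))} (r : R) : Differentials R chain :=
  (Submodule.span (Env R) {x | DiffRel chain x}).mkQ (symb r)

end Differentials

/-! ### The noncommutative structure sheaf, its tangent and its cotangent sheaf -/

namespace ModPresheaf

variable {M : MildlySingularManifold n Y} (F : ModPresheaf.{u, v} M)

/-- The endomorphism sheaf `ℰnd(F)`: its sections over `U` are the `𝒪`-linear endomorphisms of the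
restriction of `F` to `U`. -/
def endSubring (U : Opens Y) : Subring (∀ V : Iic U, Module.End (M.smoothC V.1) (F.sec V.1)) where
  carrier := {φ | ∀ (V W : Iic U) (h : W.1 ≤ V.1) (s : F.sec V.1),
    F.res h (φ V s) = φ W (F.res h s)}
  mul_mem' := fun {φ ψ} hφ hψ V W h s => by
    show F.res h (φ V (ψ V s)) = φ W (ψ W (F.res h s))
    rw [hφ, hψ]
  one_mem' := fun V W h s => rfl
  add_mem' := fun {φ ψ} hφ hψ V W h s => by
    show F.res h (φ V s + ψ V s) = φ W (F.res h s) + ψ W (F.res h s)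
    rw [map_add, hφ, hψ]
  zero_mem' := fun V W h s => map_zero _
  neg_mem' := fun {φ} hφ V W h s => by
    show F.res h (- φ V s) = - φ W (F.res h s)
    rw [map_neg, hφ]

/-- The ring of sections over `U` of the endomorphism sheaf. -/
def End (U : Opens Y) : Type (max u v) := F.endSubring U

instance (U : Opens Y) : Ring (F.End U) := inferInstanceAs (Ring (F.endSubring U))

/-- Multiplication by functions. -/
def scalar (U : Opens Y) : M.smoothC U →+* F.End U where
  toFun f := ⟨fun V => algebraMap (M.smoothC V.1) (Module.End (M.smoothC V.1) (F.sec V.1))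
      (M.restrict V.2 f), fun V W h s => by
    show F.res h (M.restrict V.2 f • s) = M.restrict W.2 f • F.res h s
    rw [F.res_smul]; rfl⟩
  map_one' := Subtype.ext (funext fun V => (congrArg _ (map_one (M.restrict V.2))).trans (map_one _))
  map_mul' f g := Subtype.ext (funext fun V =>
    (congrArg _ (map_mul (M.restrict V.2) f g)).trans (map_mul _ _ _))
  map_zero' := Subtype.ext (funext fun V => (congrArg _ (map_zero (M.restrict V.2))).trans (map_zero _))
  map_add' f g := Subtype.ext (funext fun V =>
    (congrArg _ (map_add (M.restrict V.2) f g)).trans (map_add _ _ _))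

theorem scalar_mul_comm {U : Opens Y} (f : M.smoothC U) (φ : F.End U) :
    F.scalar U f * φ = φ * F.scalar U f :=
  Subtype.ext (funext fun V => LinearMap.ext fun s => ((φ.1 V).map_smul _ s).symm)

instance (U : Opens Y) : Algebra (M.smoothC U) (F.End U) :=
  (F.scalar U).toAlgebra' (F.scalar_mul_comm)

instance (U : Opens Y) : Algebra ℂ (F.End U) :=
  ((F.scalar U).comp (algebraMap ℂ (M.smoothC U))).toAlgebra' fun _ φ => F.scalar_mul_comm _ φ

/-- Restriction in the endomorphism sheaf. -/
def endRes {U V : Opens Y} (h : V ≤ U) : F.End U →ₐ[ℂ] F.End V where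
  toFun φ := ⟨fun W => φ.1 ⟨W.1, W.2.trans h⟩, fun V' W' hW s =>
    φ.2 ⟨V'.1, V'.2.trans h⟩ ⟨W'.1, W'.2.trans h⟩ hW s⟩
  map_one' := rfl
  map_mul' _ _ := rfl
  map_zero' := rfl
  map_add' _ _ := rfl
  commutes' _ := rfl

theorem endRes_scalar {U V : Opens Y} (h : V ≤ U) (f : M.smoothC U) :
    F.endRes h (F.scalar U f) = F.scalar V (M.restrict h f) := rfl

theorem endRes_scalar_mul {U : Opens Y} (V W : Iic U) (h : W.1 ≤ V.1) (f : M.smoothC U)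
    (φ : F.End V.1) : F.endRes h (F.scalar V.1 (M.restrict V.2 f) * φ) =
      F.scalar W.1 (M.restrict W.2 f) * F.endRes h φ :=
  map_mul (F.endRes h) _ _

/-- The sections of the endomorphism sheaf over the open neighbourhoods of `q`. -/
abbrev EndAt (q : Y) (N : (OpenNhdsOf q)ᵒᵈ) : Type (max u v) :=
  F.End (OrderDual.ofDual N).toOpens

/-- The transition maps of the directed system of the `EndAt q N`. -/
abbrev endAtRes (q : Y) (N N' : (OpenNhdsOf q)ᵒᵈ) (h : N ≤ N') : F.EndAt q N →ₐ[ℂ] F.EndAt q N' :=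
  F.endRes h

instance (q : Y) : DirectedSystem (F.EndAt q) (F.endAtRes q · · ·) where
  map_self _ _ := rfl
  map_map _ _ _ _ _ _ := rfl

/-- The stalk of the endomorphism sheaf. -/
def Stalk (q : Y) : Type (max u v) := DirectLimit (F.EndAt q) (F.endAtRes q)

instance (q : Y) : Ring (F.Stalk q) :=
  inferInstanceAs (Ring (DirectLimit (F.EndAt q) (F.endAtRes q)))

instance (q : Y) : Algebra ℂ (F.Stalk q) :=
  inferInstanceAs (Algebra ℂ (DirectLimit (F.EndAt q) (F.endAtRes q)))

/-- The germ at `q` of a section of the endomorphism sheaf. -/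
def germ (U : Opens Y) (q : Y) (hq : q ∈ U) : F.End U →+* F.Stalk q where
  toFun φ := Quotient.mk _ ⟨OrderDual.toDual ⟨U, hq⟩, φ⟩
  map_one' := (DirectLimit.one_def (f := F.endAtRes q) (OrderDual.toDual ⟨U, hq⟩)).symm
  map_mul' φ ψ := (DirectLimit.mul_def (f := F.endAtRes q) (OrderDual.toDual ⟨U, hq⟩) φ ψ).symm
  map_zero' := (DirectLimit.zero_def (f := F.endAtRes q) (OrderDual.toDual ⟨U, hq⟩)).symm
  map_add' φ ψ := (DirectLimit.add_def (f := F.endAtRes q) (OrderDual.toDual ⟨U, hq⟩) φ ψ).symm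

theorem germ_endRes {U V : Opens Y} (h : V ≤ U) (q : Y) (hq : q ∈ V) (φ : F.End U) :
    F.germ V q hq (F.endRes h φ) = F.germ U q (h hq) φ :=
  DirectLimit.mk_apply (F := F.EndAt q) (f := F.endAtRes q)
    (OrderDual.toDual (⟨U, h hq⟩ : OpenNhdsOf q)) (OrderDual.toDual (⟨V, hq⟩ : OpenNhdsOf q)) φ h

/-- The instances of the chain rule in the stalk: `h` ranges over `C^∞(ℝ^s)` and `f_1, …, f_s` over
the germs of smooth real functions. -/
def stalkChain (q : Y) : Set (F.Stalk q × List (F.Stalk q × F.Stalk q)) :=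
  {x | ∃ (U : Opens Y) (hq : q ∈ U) (s : ℕ) (h : (Fin s → ℝ) → ℝ) (hh : ContDiff ℝ ∞ h)
    (f : Fin s → M.smooth U),
    x = (F.germ U q hq (F.scalar U (M.ofReal (M.compose h hh f))),
      List.ofFn fun i =>
        (F.germ U q hq (F.scalar U (M.ofReal (M.compose (MildlySingularManifold.partialDeriv h i)
          (MildlySingularManifold.contDiff_partialDeriv hh i) f))),
        F.germ U q hq (F.scalar U (M.ofReal (f i)))))}

/-- The stalk at `q` of the cotangent sheaf: the differentials of the stalk of `ℰnd(F)`. -/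
abbrev CotStalk (q : Y) : Type (max u v) := Differentials (F.Stalk q) (F.stalkChain q)

/-- The cotangent sheaf of `(Y, ℰnd(F))`: families of elements of the stalks that are locally given
by sums of terms `a (db) c` with sections `a`, `b`, `c` of `ℰnd(F)`. -/
def cotangent (U : Opens Y) : AddSubgroup (∀ q : U, F.CotStalk q.1) where
  carrier := {θ | ∀ q : U, ∃ (N : Opens Y) (_ : q.1 ∈ N) (hN : N ≤ U)
    (l : List (F.End N × F.End N × F.End N)), ∀ (r : Y) (hr : r ∈ N),
      θ ⟨r, hN hr⟩ = (l.map fun t => lmul (F.germ N r hr t.1)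
        (rmul (Differentials.d (F.germ N r hr t.2.1)) (F.germ N r hr t.2.2))).sum}
  zero_mem' := fun q => ⟨U, q.2, le_rfl, [], fun _ _ => rfl⟩
  add_mem' := fun {θ η} hθ hη q => by
    obtain ⟨N, hqN, hN, l, hl⟩ := hθ q
    obtain ⟨N', hqN', hN', l', hl'⟩ := hη q
    refine ⟨N ⊓ N', ⟨hqN, hqN'⟩, inf_le_left.trans hN,
      l.map (fun t => (F.endRes inf_le_left t.1, F.endRes inf_le_left t.2.1,
        F.endRes inf_le_left t.2.2)) ++
      l'.map (fun t => (F.endRes inf_le_right t.1, F.endRes inf_le_right t.2.1,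
        F.endRes inf_le_right t.2.2)), fun r hr => ?_⟩
    show θ ⟨r, _⟩ + η ⟨r, _⟩ = _
    rw [hl r hr.1, hl' r hr.2, List.map_append, List.sum_append, List.map_map, List.map_map]
    simp only [Function.comp_def, germ_endRes]
  neg_mem' := fun {θ} hθ q => by
    obtain ⟨N, hqN, hN, l, hl⟩ := hθ q
    refine ⟨N, hqN, hN, l.map (fun t => (-t.1, t.2)), fun r hr => ?_⟩
    show - θ ⟨r, _⟩ = _
    rw [hl r hr, List.map_map]
    have h1 : ∀ (a : F.Stalk r) (x : F.CotStalk r), lmul (-a) x = - lmul a x := fun a x => by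
      rw [eq_neg_iff_add_eq_zero, ← add_lmul, neg_add_cancel, zero_lmul]
    simp only [Function.comp_def, map_neg, h1]
    clear hl
    induction l with
    | nil => simp
    | cons a l ih => simp only [List.map_cons, List.sum_cons, neg_add, ih]

/-- Restriction in the cotangent sheaf. -/
def cotRes {U V : Opens Y} (h : V ≤ U) : F.cotangent U →+ F.cotangent V where
  toFun θ := ⟨fun q => θ.1 ⟨q.1, h q.2⟩, fun q => by
    obtain ⟨N, hqN, hN, l, hl⟩ := θ.2 ⟨q.1, h q.2⟩
    refine ⟨N ⊓ V, ⟨hqN, q.2⟩, inf_le_right,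
      l.map (fun t => (F.endRes inf_le_left t.1, F.endRes inf_le_left t.2.1,
        F.endRes inf_le_left t.2.2)), fun r hr => ?_⟩
    show θ.1 ⟨r, _⟩ = _
    rw [hl r hr.1, List.map_map]
    simp only [Function.comp_def, germ_endRes]⟩
  map_zero' := rfl
  map_add' _ _ := rfl

/-- The exterior differential. -/
def d {U : Opens Y} (φ : F.End U) : F.cotangent U :=
  ⟨fun q => Differentials.d (F.germ U q.1 q.2 φ), fun q => ⟨U, q.2, le_rfl, [(1, φ, 1)],
    fun r hr => by simp [one_lmul, rmul_one]⟩⟩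

theorem lmul_sum_mem {U : Opens Y} (a : F.End U) (θ : F.cotangent U) :
    (fun q : U => lmul (F.germ U q.1 q.2 a) (θ.1 q)) ∈ F.cotangent U := fun q => by
  obtain ⟨N, hqN, hN, l, hl⟩ := θ.2 q
  refine ⟨N, hqN, hN, l.map (fun t => (F.endRes hN a * t.1, t.2)), fun r hr => ?_⟩
  show lmul (F.germ U r (hN hr) a) (θ.1 ⟨r, hN hr⟩) = _
  rw [hl r hr, List.map_map]
  clear hl
  induction l with
  | nil => simp [lmul_zero]
  | cons t l ih =>
    simp only [List.map_cons, List.sum_cons, lmul_add, ih, Function.comp_def, map_mul,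
      germ_endRes, mul_lmul]

theorem rmul_sum_mem {U : Opens Y} (a : F.End U) (θ : F.cotangent U) :
    (fun q : U => rmul (θ.1 q) (F.germ U q.1 q.2 a)) ∈ F.cotangent U := fun q => by
  obtain ⟨N, hqN, hN, l, hl⟩ := θ.2 q
  refine ⟨N, hqN, hN, l.map (fun t => (t.1, t.2.1, t.2.2 * F.endRes hN a)), fun r hr => ?_⟩
  show rmul (θ.1 ⟨r, hN hr⟩) (F.germ U r (hN hr) a) = _
  rw [hl r hr, List.map_map]
  clear hl
  induction l with
  | nil => simp [zero_rmul]
  | cons t l ih =>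
    rw [List.map_cons, List.map_cons, List.sum_cons, List.sum_cons, add_rmul, ih]
    simp only [Function.comp_def, map_mul, germ_endRes, rmul_mul, lmul_rmul]

/-- The left `ℰnd(F)`-module structure of the cotangent sheaf. -/
instance (U : Opens Y) : Module (F.End U) (F.cotangent U) where
  smul a θ := ⟨_, F.lmul_sum_mem a θ⟩
  one_smul θ := Subtype.ext (funext fun q => by
    show lmul (F.germ U q.1 q.2 1) (θ.1 q) = _
    rw [map_one, one_lmul])
  mul_smul a b θ := Subtype.ext (funext fun q => by
    show lmul (F.germ U q.1 q.2 (a * b)) (θ.1 q) = lmul _ (lmul _ _)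
    rw [map_mul, mul_lmul])
  smul_zero a := Subtype.ext (funext fun q => lmul_zero _)
  smul_add a θ η := Subtype.ext (funext fun q => lmul_add _ _ _)
  add_smul a b θ := Subtype.ext (funext fun q => by
    show lmul (F.germ U q.1 q.2 (a + b)) (θ.1 q) = lmul _ _ + lmul _ _
    rw [map_add, add_lmul])
  zero_smul θ := Subtype.ext (funext fun q => by
    show lmul (F.germ U q.1 q.2 0) (θ.1 q) = 0
    rw [map_zero, zero_lmul])

/-- The right `ℰnd(F)`-module structure of the cotangent sheaf. -/
instance (U : Opens Y) : Module (F.End U)ᵐᵒᵖ (F.cotangent U) where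
  smul a θ := ⟨_, F.rmul_sum_mem a.unop θ⟩
  one_smul θ := Subtype.ext (funext fun q => by
    show rmul (θ.1 q) (F.germ U q.1 q.2 1) = _
    rw [map_one, rmul_one])
  mul_smul a b θ := Subtype.ext (funext fun q => by
    show rmul (θ.1 q) (F.germ U q.1 q.2 (b.unop * a.unop)) = rmul (rmul _ _) _
    rw [map_mul, rmul_mul])
  smul_zero a := Subtype.ext (funext fun q => zero_rmul _)
  smul_add a θ η := Subtype.ext (funext fun q => add_rmul _ _ _)
  add_smul a b θ := Subtype.ext (funext fun q => by
    show rmul (θ.1 q) (F.germ U q.1 q.2 (a.unop + b.unop)) = rmul _ _ + rmul _ _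
    rw [map_add, rmul_add])
  zero_smul θ := Subtype.ext (funext fun q => by
    show rmul (θ.1 q) (F.germ U q.1 q.2 0) = 0
    rw [map_zero, rmul_zero])

instance (U : Opens Y) : Module (M.smoothC U) (F.cotangent U) :=
  Module.compHom (F.cotangent U) (F.scalar U)

/-- Families of maps `X V → ℰnd(F)(V)`, for the open sets `V ≤ U`. -/
def LocalMaps (X : Opens Y → Type (max u v)) (U : Opens Y) : Type (max u v) :=
  ∀ V : Iic U, X V.1 → F.End V.1

instance (X : Opens Y → Type (max u v)) (U : Opens Y) : AddCommGroup (F.LocalMaps X U) :=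
  inferInstanceAs (AddCommGroup (∀ V : Iic U, X V.1 → F.End V.1))

instance (X : Opens Y → Type (max u v)) (U : Opens Y) : Module (M.smoothC U) (F.LocalMaps X U) where
  smul f D := fun V x => F.scalar V.1 (M.restrict V.2 f) * D V x
  one_smul D := funext fun V => funext fun x => by
    show F.scalar V.1 (M.restrict V.2 1) * D V x = D V x
    rw [map_one, map_one, one_mul]
  mul_smul f g D := funext fun V => funext fun x => by
    show F.scalar V.1 (M.restrict V.2 (f * g)) * D V x = F.scalar V.1 _ * (F.scalar V.1 _ * D V x)
    rw [map_mul, map_mul, mul_assoc]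
  smul_zero f := funext fun V => funext fun x => mul_zero _
  smul_add f D E := funext fun V => funext fun x => mul_add _ _ _
  add_smul f g D := funext fun V => funext fun x => by
    show F.scalar V.1 (M.restrict V.2 (f + g)) * D V x =
      F.scalar V.1 _ * D V x + F.scalar V.1 _ * D V x
    rw [map_add, map_add, add_mul]
  zero_smul D := funext fun V => funext fun x => by
    show F.scalar V.1 (M.restrict V.2 0) * D V x = 0
    rw [map_zero, map_zero, zero_mul]

/-- A family of maps is a `ℂ`-derivation of the restriction of the sheaf `ℰnd(F)` to `U`. -/
structure IsDerivation {U : Opens Y} (D : F.LocalMaps (fun V => F.End V) U) : Prop where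
  map_res : ∀ (V W : Iic U) (h : W.1 ≤ V.1) (a : F.End V.1),
    F.endRes h (D V a) = D W (F.endRes h a)
  map_linear : ∀ (V : Iic U) (c c' : ℂ) (a b : F.End V.1),
    D V (c • a + c' • b) = c • D V a + c' • D V b
  leibniz : ∀ (V : Iic U) (a b : F.End V.1), D V (a * b) = D V a * b + a * D V b

/-- The chain rule for smooth functions. -/
def SatisfiesChainRule {U : Opens Y} (D : F.LocalMaps (fun V => F.End V) U) : Prop :=
  ∀ (V : Iic U) (s : ℕ) (h : (Fin s → ℝ) → ℝ) (hh : ContDiff ℝ ∞ h) (f : Fin s → M.smooth V.1),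
    D V (F.scalar V.1 (M.ofReal (M.compose h hh f))) =
      ∑ i, F.scalar V.1 (M.ofReal (M.compose (MildlySingularManifold.partialDeriv h i)
          (MildlySingularManifold.contDiff_partialDeriv hh i) f)) *
        D V (F.scalar V.1 (M.ofReal (f i)))

/-- The tangent sheaf of `(Y, ℰnd(F))`: derivations of the sheaf of algebras `ℰnd(F)` that satisfy
the chain rule on smooth functions. -/
def tangent (U : Opens Y) : Submodule (M.smoothC U) (F.LocalMaps (fun V => F.End V) U) where
  carrier := {D | F.IsDerivation D ∧ F.SatisfiesChainRule D}
  zero_mem' := ⟨⟨fun V W h a => map_zero _, fun V c c' a b => by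
      show (0 : F.End V.1) = c • (0 : F.End V.1) + c' • (0 : F.End V.1)
      simp, fun V a b => by
      show (0 : F.End V.1) = 0 * b + a * 0
      simp⟩, fun V s h hh f => by
      show (0 : F.End V.1) = ∑ i, _ * (0 : F.End V.1)
      simp⟩
  add_mem' := fun {D E} hD hE => ⟨⟨fun V W h a => by
      show F.endRes h (D V a + E V a) = D W (F.endRes h a) + E W (F.endRes h a)
      rw [map_add, hD.1.map_res, hE.1.map_res], fun V c c' a b => by
      show D V _ + E V _ = c • (D V a + E V a) + c' • (D V b + E V b)
      rw [hD.1.map_linear, hE.1.map_linear, smul_add, smul_add]; abel, fun V a b => by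
      show D V _ + E V _ = (D V a + E V a) * b + a * (D V b + E V b)
      rw [hD.1.leibniz, hE.1.leibniz, add_mul, mul_add]; abel⟩, fun V s h hh f => by
      show D V _ + E V _ = ∑ i, _ * (D V _ + E V _)
      rw [hD.2 V s h hh f, hE.2 V s h hh f, ← Finset.sum_add_distrib]
      simp only [mul_add]⟩
  smul_mem' := fun f D hD => ⟨⟨fun V W h a => by
      show F.endRes h (F.scalar V.1 (M.restrict V.2 f) * D V a) =
        F.scalar W.1 (M.restrict W.2 f) * D W (F.endRes h a)
      rw [endRes_scalar_mul F V W h, hD.1.map_res], fun V c c' a b => by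
      show F.scalar V.1 (M.restrict V.2 f) * D V _ =
        c • (F.scalar V.1 (M.restrict V.2 f) * D V a) +
          c' • (F.scalar V.1 (M.restrict V.2 f) * D V b)
      rw [hD.1.map_linear, mul_add, mul_smul_comm, mul_smul_comm], fun V a b => by
      show F.scalar V.1 (M.restrict V.2 f) * D V _ =
        (F.scalar V.1 (M.restrict V.2 f) * D V a) * b +
          a * (F.scalar V.1 (M.restrict V.2 f) * D V b)
      rw [hD.1.leibniz, mul_add, mul_assoc, ← mul_assoc a, ← F.scalar_mul_comm _ a, mul_assoc]⟩,
    fun V s h hh g => by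
      show F.scalar V.1 (M.restrict V.2 f) * D V _ =
        ∑ i, _ * (F.scalar V.1 (M.restrict V.2 f) * D V _)
      rw [hD.2 V s h hh g, Finset.mul_sum]
      refine Finset.sum_congr rfl fun i _ => ?_
      rw [← mul_assoc, F.scalar_mul_comm, mul_assoc]⟩

/-- Restriction in the tangent sheaf. -/
def tanRes {U V : Opens Y} (h : V ≤ U) (D : F.tangent U) : F.tangent V :=
  ⟨fun W => D.1 ⟨W.1, W.2.trans h⟩, by
    have hD := D.2
    exact
      ⟨{ map_res := fun V' W' hW a =>
          hD.1.map_res ⟨V'.1, V'.2.trans h⟩ ⟨W'.1, W'.2.trans h⟩ hW a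
         map_linear := fun V' c c' a b => hD.1.map_linear ⟨V'.1, V'.2.trans h⟩ c c' a b
         leibniz := fun V' a b => hD.1.leibniz ⟨V'.1, V'.2.trans h⟩ a b },
        fun V' s g hg f => hD.2 ⟨V'.1, V'.2.trans h⟩ s g hg f⟩⟩

/-- The sheaf of homomorphisms of `ℰnd(F)`-bimodules from the cotangent sheaf to `ℰnd(F)`. -/
def biHom (U : Opens Y) : Submodule (M.smoothC U) (F.LocalMaps (fun V => F.cotangent V) U) where
  carrier := {Φ |
    (∀ (V W : Iic U) (h : W.1 ≤ V.1) (θ : F.cotangent V.1),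
      F.endRes h (Φ V θ) = Φ W (F.cotRes h θ)) ∧
    (∀ (V : Iic U) (θ η : F.cotangent V.1), Φ V (θ + η) = Φ V θ + Φ V η) ∧
    (∀ (V : Iic U) (a : F.End V.1) (θ : F.cotangent V.1), Φ V (a • θ) = a * Φ V θ) ∧
    (∀ (V : Iic U) (a : F.End V.1) (θ : F.cotangent V.1),
      Φ V (MulOpposite.op a • θ) = Φ V θ * a)}
  zero_mem' := ⟨fun V W h θ => map_zero _, fun V θ η => (add_zero _).symm,
    fun V a θ => (mul_zero _).symm, fun V a θ => (zero_mul _).symm⟩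
  add_mem' := fun {Φ Ψ} hΦ hΨ => ⟨fun V W h θ => by
      show F.endRes h (Φ V θ + Ψ V θ) = Φ W _ + Ψ W _
      rw [map_add, hΦ.1, hΨ.1], fun V θ η => by
      show Φ V _ + Ψ V _ = (Φ V θ + Ψ V θ) + (Φ V η + Ψ V η)
      rw [hΦ.2.1, hΨ.2.1]; abel, fun V a θ => by
      show Φ V _ + Ψ V _ = a * (Φ V θ + Ψ V θ)
      rw [hΦ.2.2.1, hΨ.2.2.1, mul_add], fun V a θ => by
      show Φ V _ + Ψ V _ = (Φ V θ + Ψ V θ) * a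
      rw [hΦ.2.2.2, hΨ.2.2.2, add_mul]⟩
  smul_mem' := fun f Φ hΦ => ⟨fun V W h θ => by
      show F.endRes h (F.scalar V.1 (M.restrict V.2 f) * Φ V θ) =
        F.scalar W.1 (M.restrict W.2 f) * Φ W _
      rw [endRes_scalar_mul F V W h, hΦ.1], fun V θ η => by
      show F.scalar V.1 (M.restrict V.2 f) * Φ V _ = F.scalar V.1 (M.restrict V.2 f) * Φ V _ +
        F.scalar V.1 (M.restrict V.2 f) * Φ V _
      rw [hΦ.2.1, mul_add], fun V a θ => by
      show F.scalar V.1 (M.restrict V.2 f) * Φ V _ = a * (F.scalar V.1 (M.restrict V.2 f) * Φ V _)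
      rw [hΦ.2.2.1, ← mul_assoc, F.scalar_mul_comm, mul_assoc], fun V a θ => by
      show F.scalar V.1 (M.restrict V.2 f) * Φ V _ = F.scalar V.1 (M.restrict V.2 f) * Φ V _ * a
      rw [hΦ.2.2.2, mul_assoc]⟩

/-- Restriction in the sheaf of bimodule homomorphisms. -/
def biHomRes {U V : Opens Y} (h : V ≤ U) (Φ : F.biHom U) : F.biHom V :=
  ⟨fun W => Φ.1 ⟨W.1, W.2.trans h⟩, by
    have hΦ := Φ.2
    exact ⟨fun V' W' hW θ => hΦ.1 ⟨V'.1, V'.2.trans h⟩ ⟨W'.1, W'.2.trans h⟩ hW θ,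
      fun V' θ η => hΦ.2.1 ⟨V'.1, V'.2.trans h⟩ θ η,
      fun V' a θ => hΦ.2.2.1 ⟨V'.1, V'.2.trans h⟩ a θ,
      fun V' a θ => hΦ.2.2.2 ⟨V'.1, V'.2.trans h⟩ a θ⟩⟩

end ModPresheaf

end AzumayaType

end

noncomputable section

namespace AzumayaType

/-! ### Hadamard's lemma -/

/-! The duality is the universal property of differentials, passed from stalks to sheaves. A
bimodule homomorphism `Φ` yields the derivation `b ↦ Φ (db)`, because `d` is linear and satisfies
the Leibniz and chain rules. It is determined by this derivation, because cotangent sections are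
locally sums of terms `a (db) c`. Conversely, a tangent section `ξ` commutes with restriction and so
acts on the stalks of the endomorphism sheaf. There it respects all the relations that define the
differentials; the relation `(dr) z = z dr` holds because `ξ r`, like every element, commutes with a
central `z`. This gives an evaluation on each cotangent stalk. On a cotangent section that is
locally `∑ a (db) c` the resulting germs are those of `∑ a (ξ b) c`, so they glue
(`IsSheaf.toTangent_surjective`). Nondegeneracy then follows by testing on the sections `db`.

The gluing requires the endomorphism sheaf to be a sheaf, hence the sections of the settlement to
form one (`TameSettlement.isSheaf_sections`). This is where the geometry enters. At smooth points a
section is a family of fibre values, and these glue trivially. At a singularity `p` it is an actual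
section of the bundle around `p`, which has to be built over the union of the cover. Only one block
occurs near `p`, so descriptions in nearby bundle charts translate to the chart at `p`. Two sections
that describe the same values agree wherever the bundle is locally free, so only their germs at `p`
must be compared.

Over the smooth locus the chain rule is automatic. Hadamard's lemma at `f(q)` shows that `D (h(f)) -
∑ ∂ᵢh(f) D fᵢ` is a sum of endomorphisms multiplied by functions that vanish at `q`. It therefore
sends every section into `𝔪_q` times the sections, for each `q`, and a section without singular
points that has this property at all `q` is zero (`TameSettlement.sections_eq_zero`). -/

/-- Induction on `m` by differentiation under the integral sign. The derivative of the integrand in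
`x` has values in `E →L[ℝ] G`, so the target `G` must vary in the induction. -/
theorem contDiff_intervalIntegral_of_nat {E : Type} [NormedAddCommGroup E] [NormedSpace ℝ E]
    [FiniteDimensional ℝ E] (m : ℕ) : ∀ {G : Type} [NormedAddCommGroup G] [NormedSpace ℝ G]
    [CompleteSpace G] {f : E → ℝ → G}, ContDiff ℝ m (Function.uncurry f) →
      ContDiff ℝ m fun x => ∫ t in (0 : ℝ)..1, f x t := by
  induction m with
  | zero =>
    intro G _ _ _ f hf
    rw [Nat.cast_zero, contDiff_zero] at hf ⊢
    exact intervalIntegral.continuous_parametric_intervalIntegral_of_continuous' hf 0 1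
  | succ m ih =>
    intro G _ _ _ f hf
    set f' : E → ℝ → E →L[ℝ] G := fun x t =>
      (fderiv ℝ (Function.uncurry f) (x, t)).comp (ContinuousLinearMap.inl ℝ E ℝ) with hf'
    have hsm : ContDiff ℝ m (Function.uncurry f') :=
      (hf.fderiv_right (m := m) (by norm_cast)).clm_comp contDiff_const
    have hcont : Continuous (Function.uncurry f) := hf.continuous
    have hcont' : Continuous (Function.uncurry f') := hsm.continuous
    rw [Nat.cast_succ, contDiff_succ_iff_hasFDerivAt]
    refine ⟨fun x => ∫ t in (0 : ℝ)..1, f' x t, ih hsm, fun x => ?_⟩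
    -- Finite dimension makes the closed ball compact; the bound of the continuous `f'` on ball
    -- times interval is the dominating function.
    obtain ⟨C, hC⟩ := ((isCompact_closedBall x 1).prod (isCompact_Icc (a := (0 : ℝ)) (b := 1))
      ).exists_bound_of_continuousOn hcont'.continuousOn
    refine intervalIntegral.hasFDerivAt_integral_of_dominated_of_fderiv_le
      (F := f) (F' := f') (bound := fun _ => C)
      (Metric.closedBall_mem_nhds x one_pos)
      (Filter.Eventually.of_forall fun y => ?_) ?_ ?_ ?_ ?_ ?_
    · exact (hcont.comp (Continuous.prodMk_right y)).aestronglyMeasurable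
    · exact (hcont.comp (Continuous.prodMk_right x)).intervalIntegrable 0 1
    · exact (hcont'.comp (Continuous.prodMk_right x)).aestronglyMeasurable
    · refine Filter.Eventually.of_forall fun t ht y hy => hC (y, t) ⟨hy, ?_⟩
      rw [uIoc_of_le zero_le_one] at ht
      exact ⟨ht.1.le, ht.2⟩
    · exact intervalIntegrable_const
    · refine Filter.Eventually.of_forall fun t _ y _ => ?_
      have h1 : HasFDerivAt (Function.uncurry f) (fderiv ℝ (Function.uncurry f) (y, t)) (y, t) :=
        (hf.differentiable (by simp) _).hasFDerivAt
      have h2 : HasFDerivAt (fun e : E => (e, t)) (ContinuousLinearMap.inl ℝ E ℝ) y :=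
        hasFDerivAt_prodMk_left y t
      exact HasFDerivAt.comp (g := Function.uncurry f) (f := fun e : E => (e, t)) y h1 h2

theorem contDiff_intervalIntegral {E : Type} [NormedAddCommGroup E] [NormedSpace ℝ E]
    [FiniteDimensional ℝ E] {G : Type} [NormedAddCommGroup G] [NormedSpace ℝ G]
    [CompleteSpace G] {f : E → ℝ → G} (hf : ContDiff ℝ ∞ (Function.uncurry f)) :
    ContDiff ℝ ∞ fun x => ∫ t in (0 : ℝ)..1, f x t :=
  contDiff_infty.2 fun m => contDiff_intervalIntegral_of_nat m (contDiff_infty.1 hf m)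

namespace MildlySingularManifold

/-- Hadamard's lemma: the first-order Taylor expansion with smooth coefficients. -/
theorem exists_hadamard {s : ℕ} {h : (Fin s → ℝ) → ℝ} (hh : ContDiff ℝ ∞ h) (y₀ : Fin s → ℝ) :
    ∃ g : Fin s → (Fin s → ℝ) → ℝ, (∀ i, ContDiff ℝ ∞ (g i)) ∧
      (∀ i, g i y₀ = partialDeriv h i y₀) ∧
      ∀ y, h y = h y₀ + ∑ i, g i y * (y i - y₀ i) := by
  have hs : ∀ i, ContDiff ℝ ∞ (Function.uncurry fun (y : Fin s → ℝ) (t : ℝ) =>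
      partialDeriv h i (y₀ + t • (y - y₀))) := fun i =>
    (contDiff_partialDeriv hh i).comp
      (contDiff_const.add (contDiff_snd.smul (contDiff_fst.sub contDiff_const)))
  -- Integrating the derivative of `t ↦ h (y₀ + t (y - y₀))` over `[0, 1]` produces these
  -- coefficients; at `y = y₀` the integrand is constant in `t`.
  refine ⟨fun i y => ∫ t in (0 : ℝ)..1, partialDeriv h i (y₀ + t • (y - y₀)),
    fun i => contDiff_intervalIntegral (hs i), fun i => by simp, fun y => ?_⟩
  have hd : ∀ t : ℝ, HasDerivAt (fun t : ℝ => h (y₀ + t • (y - y₀)))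
      (∑ i, partialDeriv h i (y₀ + t • (y - y₀)) * (y i - y₀ i)) t := fun t => by
    have h1 : HasDerivAt (fun t : ℝ => y₀ + t • (y - y₀)) (y - y₀) t := by
      simpa using ((hasDerivAt_id t).smul_const (y - y₀)).const_add y₀
    have h2 := ((hh.differentiable (by simp) (y₀ + t • (y - y₀))).hasFDerivAt).comp_hasDerivAt t h1
    refine h2.congr_deriv ?_
    have h3 : y - y₀ = ∑ i, (y i - y₀ i) • (Pi.single i 1 : Fin s → ℝ) := by
      ext j
      simp [Finset.sum_apply, Pi.single_apply]
    simp only [partialDeriv]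
    generalize fderiv ℝ h (y₀ + t • (y - y₀)) = L
    rw [h3, map_sum]
    refine Finset.sum_congr rfl fun i _ => ?_
    rw [map_smul, smul_eq_mul, mul_comm]
  have hc : ∀ i, Continuous fun t : ℝ => partialDeriv h i (y₀ + t • (y - y₀)) := fun i =>
    (hs i).continuous.comp (Continuous.prodMk_right y)
  have h3 := intervalIntegral.integral_eq_sub_of_hasDerivAt (a := 0) (b := 1) (fun t _ => hd t)
    ((continuous_finsetSum _ fun i _ => (hc i).mul continuous_const).intervalIntegrable 0 1)
  rw [intervalIntegral.integral_finsetSum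
    (f := fun i t => partialDeriv h i (y₀ + t • (y - y₀)) * (y i - y₀ i))
    fun i _ => ((hc i).mul continuous_const).intervalIntegrable 0 1] at h3
  simp only [intervalIntegral.integral_mul_const] at h3
  rw [h3]
  simp

end MildlySingularManifold

variable {n : ℕ} {Y : Type u} [TopologicalSpace Y]

namespace ModPresheaf

variable {M : MildlySingularManifold n Y} {F : ModPresheaf.{u, v} M}

/-! ### Sheaves of modules -/

theorem res_self {U : Opens Y} (h : U ≤ U) (s : F.sec U) : F.res h s = s := F.res_refl s

/-- Gluing over a set that is merely covered, rather than written as a supremum, spares the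
transport of sections along an equality of open sets. -/
theorem IsSheaf.exists_glue (hF : F.IsSheaf) {ι : Type u} {V : Opens Y} {N : ι → Opens Y}
    (hN : ∀ i, N i ≤ V) (hV : ∀ q ∈ V, ∃ i, q ∈ N i) (s : ∀ i, F.sec (N i))
    (hs : ∀ i j, F.res (inf_le_left : N i ⊓ N j ≤ N i) (s i) =
      F.res (inf_le_right : N i ⊓ N j ≤ N j) (s j)) :
    ∃ t : F.sec V, ∀ i, F.res (hN i) t = s i := by
  obtain rfl : V = ⨆ i, N i :=
    le_antisymm (fun q hq => Opens.mem_iSup.2 (hV q hq)) (iSup_le hN)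
  exact (hF ι N s hs).exists

theorem IsSheaf.eq_of_locally (hF : F.IsSheaf) {V : Opens Y} {s t : F.sec V}
    (h : ∀ q ∈ V, ∃ (N : Opens Y) (hN : N ≤ V), q ∈ N ∧ F.res hN s = F.res hN t) : s = t := by
  choose N hN hq hst using fun q : V => h q.1 q.2
  have hV : V = ⨆ q, N q :=
    le_antisymm (fun q hq' => Opens.mem_iSup.2 ⟨⟨q, hq'⟩, hq _⟩) (iSup_le hN)
  -- The cover is indexed by the points of `V`, so `V = ⨆ q, N q` cannot be substituted for `V`
  -- itself; a separate variable `W` can be replaced by the supremum.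
  have key : ∀ {W : Opens Y} (hVW : V = W) (hN' : ∀ q, N q ≤ W) (s t : F.sec W),
      (∀ q, F.res (hN' q) s = F.res (hN' q) t) → W = (⨆ q, N q) → s = t := by
    rintro W - hN' s t hst rfl
    refine (hF V N (fun q => F.res (hN' q) t) fun i j => ?_).unique (fun q => hst q) fun q => rfl
    rw [F.res_res, F.res_res]
  exact key rfl hN s t hst hV

/-- An element of `𝔪_q F` is a sum of products `f • x` with `f(q) = 0`. Expanding each `x` in the
basis gives coefficients that vanish at `q`, and by uniqueness these are the restrictions of the
given ones. -/
theorem VanishAt.coeff_eq_zero {N : Opens Y} {r : ℕ} {b : Fin r → F.sec N}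
    (hb : ∀ (V : Opens Y) (hV : V ≤ N) (s : F.sec V),
      ∃! c : Fin r → M.smoothC V, s = ∑ k, c k • F.res hV (b k))
    {V : Opens Y} (hV : V ≤ N) {c : Fin r → M.smoothC V} {q : Y} (hq : q ∈ V)
    (h : F.VanishAt (∑ k, c k • F.res hV (b k)) q) (k : Fin r) : (c k).1 ⟨q, hq⟩ = 0 := by
  obtain ⟨W, hW, hqW, h⟩ := h
  have key : ∀ s : F.sec W, s ∈ M.idealAt W q hqW • (⊤ : Submodule (M.smoothC W) (F.sec W)) →
      ∃ c : Fin r → M.smoothC W, (∀ k, (c k).1 ⟨q, hqW⟩ = 0) ∧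
        s = ∑ k, c k • F.res (hW.trans hV) (b k) := fun s hs => by
    induction hs using Submodule.smul_induction_on' with
    | smul f hf x hx =>
      obtain ⟨c, hc, -⟩ := hb W (hW.trans hV) x
      refine ⟨fun k => f * c k, fun k => ?_, ?_⟩
      · show f.1 _ * (c k).1 _ = 0
        rw [show f.1 _ = 0 from hf, zero_mul]
      · simp only [mul_smul, ← Finset.smul_sum]
        rw [← hc]
    | add x hx y hy ihx ihy =>
      obtain ⟨c, hc, hx⟩ := ihx
      obtain ⟨c', hc', hy⟩ := ihy
      refine ⟨fun k => c k + c' k, fun k => ?_, ?_⟩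
      · show (c k).1 _ + (c' k).1 _ = 0
        rw [hc, hc', add_zero]
      · simp only [add_smul, Finset.sum_add_distrib, ← hx, ← hy]
  obtain ⟨c', hc', h'⟩ := key _ h
  have h2 : F.res hW (∑ k, c k • F.res hV (b k)) =
      ∑ k, M.restrict hW (c k) • F.res (hW.trans hV) (b k) := by
    simp only [map_sum, F.res_smul, F.res_res]
  have h3 := (hb W (hW.trans hV) _).unique h2 h'
  have h4 := hc' k
  rw [← h3] at h4
  exact h4

/-- Near a smooth point a section of a bundle that is zero in all fibres is zero. -/
theorem IsMildlySingularBundle.eq_zero_of_vanishAt {W : Opens Y}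
    (hF : F.IsMildlySingularBundle W) {V : Opens Y} {s : F.sec V} {q : Y} (hq : q ∈ V)
    (hqW : q ∈ W) (hqs : q ∉ M.sing) (h : ∀ q' ∈ V, q' ∉ M.sing → F.VanishAt s q') :
    ∃ (N : Opens Y) (hN : N ≤ V), q ∈ N ∧ F.res hN s = 0 := by
  obtain ⟨N, hqN, hNW, r, b, hb⟩ := hF.1 q hqW hqs
  -- Vanishing is assumed at smooth points only. On `N'` every point is smooth, so each coefficient
  -- is zero at all points and hence zero as a function.
  let N' : Opens Y := V ⊓ N ⊓ M.smoothLocus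
  have hN'V : N' ≤ V := inf_le_left.trans inf_le_left
  have hN'N : N' ≤ N := inf_le_left.trans inf_le_right
  refine ⟨N', hN'V, ⟨⟨hq, hqN⟩, hqs⟩, ?_⟩
  obtain ⟨c, hc, -⟩ := hb N' hN'N (F.res hN'V s)
  have : ∀ k, c k = 0 := fun k => Subtype.ext (funext fun x => by
    refine VanishAt.coeff_eq_zero hb hN'N x.2 ?_ k
    rw [← hc]
    exact (h x.1 (hN'V x.2) x.2.2).res hN'V x.2)
  rw [hc]
  simp [this]

end ModPresheaf

/-! ### The sheaf of sections of a tame settlement -/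

namespace TameSettlement

variable {M : MildlySingularManifold n Y} {P : RegularPartition.{u, w} M}
  {𝔖 : TameSettlement.{u, v, w} P}

/-- Near a singularity there is only one block. -/
theorem dist_eq_of_mem_chartNhd {p : Y} (hp : p ∈ M.sing) {q : Y} (hq : q ∈ 𝔖.chartNhd p) :
    𝔖.dist q = 𝔖.dist p := by
  obtain ⟨i, -, hi⟩ := P.sing_interior p hp
  have key : ∀ j, p ∈ P.block j → j = i := fun j hj => by
    by_contra hne
    exact mem_of_mem_nhds (hi j hne) hj
  rw [key _ (𝔖.chartNhd_block p q hq _ (𝔖.dist_terminal q).1), key _ (𝔖.dist_terminal p).1]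

/-- A bundle chart is the identity on its own distinguished block. Since `j` is a variable, the
equality of blocks can be substituted. -/
theorem chart_chart {p q : Y} {j : P.I} (hj : j = 𝔖.dist q) (V : Opens Y)
    (h1 : V ≤ 𝔖.chartNhd p ⊓ 𝔖.dom (𝔖.dist q)) (h2 : V ≤ 𝔖.chartNhd q ⊓ 𝔖.dom j)
    (h3 : V ≤ 𝔖.chartNhd p ⊓ 𝔖.dom j) (s : (𝔖.ext j).sec V) :
    (𝔖.chart p (𝔖.dist q)).map V h1 ((𝔖.chart q j).map V h2 s) = (𝔖.chart p j).map V h3 s := by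
  subst hj
  rw [𝔖.chart_dist]

/-- The representatives `s` and `s'` of the value at `q` differ by something zero in the fibre, and
bundle maps preserve this. -/
theorem InChart.vanishAt_sub {V : Opens Y} {x : 𝔖.PreSec V} {p : Y} {N : Opens Y}
    {hN : N ≤ V ⊓ 𝔖.chartNhd p} {t t' : (𝔖.ext (𝔖.dist p)).sec N}
    (h : 𝔖.InChart x p N hN t) (h' : 𝔖.InChart x p N hN t') {q : Y} (hq : q ∈ N)
    (hqs : q ∉ M.sing) : (𝔖.ext (𝔖.dist p)).VanishAt (t - t') q := by
  obtain ⟨s, h1, h2⟩ := h q hq hqs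
  obtain ⟨s', h1', h2'⟩ := h' q hq hqs
  have h3 : (𝔖.ext (𝔖.dist q)).VanishAt (s - s') q :=
    (Submodule.Quotient.eq ((𝔖.ext (𝔖.dist q)).vanishing _ q (𝔖.mem_chartNhd q))).1
      (h1.trans h1'.symm)
  have hle : N ⊓ 𝔖.chartNhd q ≤ 𝔖.chartNhd p ⊓ 𝔖.dom (𝔖.dist q) :=
    le_inf (inf_le_left.trans (hN.trans inf_le_right))
      (inf_le_right.trans (𝔖.chartNhd_le_dom q))
  have hqN : q ∈ N ⊓ 𝔖.chartNhd q := ⟨hq, 𝔖.mem_chartNhd q⟩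
  have h4 := (h3.res (V := N ⊓ 𝔖.chartNhd q) inf_le_right hqN).hom
    (𝔖.chart p (𝔖.dist q)) hle
  -- With `χ` the chart map, `t - t' = χ(s - s') - (χ s - t) + (χ s' - t')`.
  have h5 := (h4.add ((h2.smul (-1)).add h2'))
  have h6 : (𝔖.ext (𝔖.dist p)).VanishAt
      ((𝔖.ext (𝔖.dist p)).res (inf_le_left : N ⊓ 𝔖.chartNhd q ≤ N) (t - t')) q := by
    convert h5 using 1
    simp only [map_sub, neg_smul, one_smul]
    abel
  obtain ⟨W, hW, hqW, h7⟩ := h6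
  exact ⟨W, hW.trans inf_le_left, hqW, by rwa [ModPresheaf.res_res] at h7⟩

/-- A section of the bundle block at `p` that carries given values in the bundle chart is
determined by its germ at `p`. -/
theorem InChart.eq {V : Opens Y} {x : 𝔖.PreSec V} {p : Y} {N : Opens Y}
    {hN : N ≤ V ⊓ 𝔖.chartNhd p} {t t' : (𝔖.ext (𝔖.dist p)).sec N}
    (h : 𝔖.InChart x p N hN t) (h' : 𝔖.InChart x p N hN t')
    (hp : p ∈ M.sing → p ∈ N → ∃ (N₀ : Opens Y) (h₀ : N₀ ≤ N), p ∈ N₀ ∧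
      (𝔖.ext (𝔖.dist p)).res h₀ t = (𝔖.ext (𝔖.dist p)).res h₀ t') : t = t' := by
  refine (𝔖.isSheaf (𝔖.dist p)).eq_of_locally fun q hq => ?_
  -- The only possible singularity in the chart domain is `p`, where equality near `p` is assumed.
  -- Elsewhere the bundle is locally free and the difference is zero in all nearby smooth fibres.
  by_cases hqs : q ∈ M.sing
  · obtain rfl := 𝔖.chartNhd_sing p q (hN hq).2 hqs
    exact hp hqs hq
  · obtain ⟨N', hN', hqN', h0⟩ := (𝔖.isBundle (𝔖.dist p)).eq_zero_of_vanishAt hq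
      (𝔖.chartNhd_le_dom p (hN hq).2) hqs fun q' hq' hs' => h.vanishAt_sub h' hq' hs'
    exact ⟨N', hN', hqN', by rwa [map_sub, sub_eq_zero] at h0⟩

/-- Near a singularity `p`, local descriptions in other bundle charts are descriptions in the
bundle chart at `p`. -/
theorem InChart.toSing {V : Opens Y} {x : 𝔖.PreSec V} {p q : Y} (hp : p ∈ M.sing) {N : Opens Y}
    {hN : N ≤ V ⊓ 𝔖.chartNhd q} {t : (𝔖.ext (𝔖.dist q)).sec N} (hq : q ∈ 𝔖.chartNhd p)
    (h : 𝔖.InChart x q N hN t) (hNp : N ≤ V ⊓ 𝔖.chartNhd p) :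
    𝔖.InChart x p N hNp ((𝔖.chart p (𝔖.dist q)).map N
      (le_inf (hNp.trans inf_le_right) (hN.trans (inf_le_right.trans (𝔖.chartNhd_le_dom q)))) t) := by
  intro q' hq' hs'
  obtain ⟨s, h1, h2⟩ := h q' hq' hs'
  refine ⟨s, h1, ?_⟩
  -- Both points lie in the chart domain of `p`, where a single block occurs. So applying the chart
  -- map of `p` to the relation in the chart at `q` gives the relation in the chart at `p`.
  have hj : 𝔖.dist q' = 𝔖.dist q :=
    (dist_eq_of_mem_chartNhd hp (hNp hq').2).trans (dist_eq_of_mem_chartNhd hp hq).symm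
  have hle : N ⊓ 𝔖.chartNhd q' ≤ 𝔖.chartNhd p ⊓ 𝔖.dom (𝔖.dist q) :=
    le_inf (inf_le_left.trans (hNp.trans inf_le_right))
      (inf_le_left.trans (hN.trans (inf_le_right.trans (𝔖.chartNhd_le_dom q))))
  have h3 := h2.hom (𝔖.chart p (𝔖.dist q)) hle
  rw [map_sub, chart_chart hj] at h3
  rwa [ModPresheaf.HomOn.map_res]

theorem InChart.congr {V W : Opens Y} {x : 𝔖.PreSec V} {y : 𝔖.PreSec W} {p : Y} {N : Opens Y}
    {hN : N ≤ V ⊓ 𝔖.chartNhd p} {t : (𝔖.ext (𝔖.dist p)).sec N} (h : 𝔖.InChart x p N hN t)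
    (hN' : N ≤ W ⊓ 𝔖.chartNhd p)
    (hxy : ∀ (q : Y) (hV : q ∈ V) (hW : q ∈ W) (hs : q ∉ M.sing),
      x.1 ⟨q, hV, hs⟩ = y.1 ⟨q, hW, hs⟩) : 𝔖.InChart y p N hN' t := fun q hq hs => by
  obtain ⟨s, h1, h2⟩ := h q hq hs
  exact ⟨s, h1.trans (hxy q (hN hq).1 (hN' hq).1 hs), h2⟩

theorem InChart.res {V : Opens Y} {x : 𝔖.PreSec V} {p : Y} {N N' : Opens Y}
    {hN : N ≤ V ⊓ 𝔖.chartNhd p} {t : (𝔖.ext (𝔖.dist p)).sec N} (h : 𝔖.InChart x p N hN t)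
    (hNN : N' ≤ N) : 𝔖.InChart x p N' (hNN.trans hN) ((𝔖.ext (𝔖.dist p)).res hNN t) :=
  h.mono le_rfl (fun _ => rfl) _ hNN

/-- Being given in a bundle chart by a section is a local property. -/
theorem InChart.of_locally {V : Opens Y} {x : 𝔖.PreSec V} {p : Y} {N : Opens Y}
    {hN : N ≤ V ⊓ 𝔖.chartNhd p} {t : (𝔖.ext (𝔖.dist p)).sec N}
    (h : ∀ q ∈ N, ∃ (N' : Opens Y) (hN' : N' ≤ N), q ∈ N' ∧
      𝔖.InChart x p N' (hN'.trans hN) ((𝔖.ext (𝔖.dist p)).res hN' t)) :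
    𝔖.InChart x p N hN t := fun q hq hs => by
  obtain ⟨N', hN', hqN', h'⟩ := h q hq
  obtain ⟨s, h1, W, hW, hqW, h2⟩ := h' q hqN' hs
  refine ⟨s, h1, W, hW.trans (inf_le_inf_right _ hN'), hqW, ?_⟩
  rw [map_sub, ModPresheaf.HomOn.map_res] at h2 ⊢
  simp only [ModPresheaf.res_res] at h2 ⊢
  exact h2

/-- A family of values that is smooth near a singularity `p`, outside of `p`, and is given at `p` by
a section of the bundle block extends this section over the domain of the bundle chart. -/
theorem exists_inChart {V : Opens Y} {x : 𝔖.PreSec V} {p : Y} (hp : p ∈ M.sing)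
    {N₀ : Opens Y} (hN₀ : N₀ ≤ V ⊓ 𝔖.chartNhd p) (hpN₀ : p ∈ N₀)
    {t₀ : (𝔖.ext (𝔖.dist p)).sec N₀} (h₀ : 𝔖.InChart x p N₀ hN₀ t₀)
    (hx : ∀ q ∈ V, q ∉ M.sing → ∃ (N : Opens Y) (hN : N ≤ V ⊓ 𝔖.chartNhd q) (_ : q ∈ N)
      (t : (𝔖.ext (𝔖.dist q)).sec N), 𝔖.InChart x q N hN t) :
    ∃ t : (𝔖.ext (𝔖.dist p)).sec (V ⊓ 𝔖.chartNhd p),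
      𝔖.InChart x p (V ⊓ 𝔖.chartNhd p) le_rfl t ∧ (𝔖.ext (𝔖.dist p)).res hN₀ t = t₀ := by
  -- The cover consists of `N₀` and of neighbourhoods of smooth points with the singularities
  -- removed. Hence any member that contains `p` lies in `N₀` and carries a restriction of `t₀`.
  have hloc : ∀ q : (V ⊓ 𝔖.chartNhd p : Opens Y), ∃ (N : Opens Y) (hN : N ≤ V ⊓ 𝔖.chartNhd p)
      (_ : q.1 ∈ N) (t : (𝔖.ext (𝔖.dist p)).sec N), 𝔖.InChart x p N hN t ∧
      (p ∈ N → ∃ h : N ≤ N₀, t = (𝔖.ext (𝔖.dist p)).res h t₀) := fun q => by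
    by_cases hq : q.1 ∈ M.sing
    · have hqp : q.1 = p := 𝔖.chartNhd_sing p q.1 q.2.2 hq
      exact ⟨N₀, hN₀, by rw [hqp]; exact hpN₀, t₀, h₀,
        fun _ => ⟨le_rfl, (ModPresheaf.res_self _ _).symm⟩⟩
    · obtain ⟨N, hN, hqN, t, h⟩ := hx q.1 q.2.1 hq
      refine ⟨N ⊓ 𝔖.chartNhd p ⊓ M.smoothLocus,
        le_inf (inf_le_left.trans (inf_le_left.trans (hN.trans inf_le_left)))
          (inf_le_left.trans inf_le_right), ⟨⟨hqN, q.2.2⟩, hq⟩, _,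
        (h.res (inf_le_left.trans inf_le_left)).toSing hp q.2.2 _, fun h => (h.2 hp).elim⟩
  choose N hN hqN t ht hpt using hloc
  -- On an overlap both sections describe the values `x`; if the overlap contains `p`, both are
  -- restrictions of `t₀`.
  have hagree : ∀ i j, (𝔖.ext (𝔖.dist p)).res (inf_le_left : N i ⊓ N j ≤ N i) (t i) =
      (𝔖.ext (𝔖.dist p)).res (inf_le_right : N i ⊓ N j ≤ N j) (t j) := fun i j =>
    ((ht i).res inf_le_left).eq ((ht j).res inf_le_right) fun _ hpij => by
      obtain ⟨hi, hi'⟩ := hpt i hpij.1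
      obtain ⟨hj, hj'⟩ := hpt j hpij.2
      refine ⟨N i ⊓ N j, le_rfl, hpij, ?_⟩
      rw [hi', hj']
      simp only [ModPresheaf.res_res]
  obtain ⟨T, hT⟩ := (𝔖.isSheaf (𝔖.dist p)).exists_glue hN (fun q hq => ⟨⟨q, hq⟩, hqN _⟩) t hagree
  have hTin : 𝔖.InChart x p (V ⊓ 𝔖.chartNhd p) le_rfl T := InChart.of_locally fun q hq =>
    ⟨N ⟨q, hq⟩, hN _, hqN _, by rw [hT]; exact ht _⟩
  obtain ⟨h2, h3⟩ := hpt ⟨p, hN₀ hpN₀⟩ (hqN ⟨p, hN₀ hpN₀⟩)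
  exact ⟨T, hTin, (hTin.res hN₀).eq h₀ fun _ _ =>
    ⟨_, h2, hqN ⟨p, hN₀ hpN₀⟩, by rw [ModPresheaf.res_res, hT, h3]⟩⟩

theorem sections_ext {V : Opens Y} {x y : 𝔖.sections.sec V} (h1 : ∀ q, x.1.1 q = y.1.1 q)
    (h2 : ∀ p, x.1.2 p = y.1.2 p) : x = y :=
  Subtype.ext (PreSec.ext h1 h2)

/-- The fibre at a smooth point does not depend on the open set, so values glue pointwise. The work
is at a singularity `p`: the section there must live over the whole union intersected with the chart
domain, and `exists_inChart` extends it from one chosen member of the cover. -/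
theorem isSheaf_sections : 𝔖.sections.IsSheaf := by
  intro ι U s hs
  have hcov : ∀ q : Y, q ∈ (⨆ i, U i) → ∃ i, q ∈ U i := fun q hq => Opens.mem_iSup.1 hq
  have hs1 : ∀ i j (q : Y) (hi : q ∈ U i) (hj : q ∈ U j) (hq : q ∉ M.sing),
      (s i).1.1 ⟨q, hi, hq⟩ = (s j).1.1 ⟨q, hj, hq⟩ := fun i j q hi hj hq =>
    congrFun (congrArg (fun z => z.1.1) (hs i j)) ⟨q, ⟨hi, hj⟩, hq⟩
  have hs2 : ∀ i j (p : Y) (hi : p ∈ U i) (hj : p ∈ U j) (hp : p ∈ M.sing),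
      (𝔖.ext (𝔖.dist p)).res (inf_le_inf_right _ inf_le_left)
        ((s i).1.2 ⟨p, hi, hp⟩) =
      (𝔖.ext (𝔖.dist p)).res (inf_le_inf_right (𝔖.chartNhd p) (inf_le_right : U i ⊓ U j ≤ U j))
        ((s j).1.2 ⟨p, hj, hp⟩) := fun i j p hi hj hp =>
    congrFun (congrArg (fun z => z.1.2) (hs i j)) ⟨p, ⟨hi, hj⟩, hp⟩
  choose c hc using hcov
  let x₀ : 𝔖.PreSec (⨆ i, U i) := (fun q => (s (c q.1 q.2.1)).1.1 ⟨q.1, hc q.1 q.2.1, q.2.2⟩, 0)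
  have hx₀ : ∀ i (q : Y) (hi : q ∈ U i) (hV : q ∈ ⨆ i, U i) (hq : q ∉ M.sing),
      (s i).1.1 ⟨q, hi, hq⟩ = x₀.1 ⟨q, hV, hq⟩ := fun i q hi hV hq => hs1 _ _ q hi (hc q hV) hq
  have hle : ∀ i, U i ≤ ⨆ i, U i := le_iSup U
  have hloc : ∀ q ∈ (⨆ i, U i), q ∉ M.sing → ∃ (N : Opens Y)
      (hN : N ≤ (⨆ i, U i) ⊓ 𝔖.chartNhd q) (_ : q ∈ N)
      (t : (𝔖.ext (𝔖.dist q)).sec N), 𝔖.InChart x₀ q N hN t := fun q hq hqs => by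
    obtain ⟨N, hN, hqN, t, h⟩ := (s (c q hq)).2.1 q (hc q hq) hqs
    exact ⟨N, hN.trans (inf_le_inf_right _ (hle _)), hqN, t,
      h.congr _ fun q' hV hW hq' => hx₀ _ q' hV hW hq'⟩
  have hsing : ∀ p : {p : Y // p ∈ (⨆ i, U i) ∧ p ∈ M.sing}, ∃ t,
      𝔖.InChart x₀ p.1 ((⨆ i, U i) ⊓ 𝔖.chartNhd p.1) le_rfl t ∧
      (𝔖.ext (𝔖.dist p.1)).res (inf_le_inf_right _ (hle (c p.1 p.2.1))) t =
        (s (c p.1 p.2.1)).1.2 ⟨p.1, hc p.1 p.2.1, p.2.2⟩ := fun p =>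
    exists_inChart p.2.2 (inf_le_inf_right _ (hle (c p.1 p.2.1))) ⟨hc p.1 p.2.1, 𝔖.mem_chartNhd _⟩
      (((s (c p.1 p.2.1)).2.2 ⟨p.1, hc p.1 p.2.1, p.2.2⟩).congr _
        fun q' hV hW hq' => hx₀ _ q' hV hW hq') hloc
  choose t ht htc using hsing
  let x : 𝔖.sections.sec (⨆ i, U i) := ⟨(x₀.1, t), fun p hp hps => by
    obtain ⟨N, hN, hpN, t, h⟩ := hloc p hp hps
    exact ⟨N, hN, hpN, t, h.congr _ fun _ _ _ _ => rfl⟩,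
    fun p => (ht p).congr _ fun _ _ _ _ => rfl⟩
  refine ⟨x, fun i => sections_ext (fun q => (hx₀ i q.1 q.2.1 (hle i q.2.1) q.2.2).symm) fun p => ?_,
    fun y hy => sections_ext (fun q => ?_) fun p => ?_⟩
  · have hpc : p.1 ∈ U (c p.1 (hle i p.2.1)) := hc p.1 (hle i p.2.1)
    refine InChart.eq (x := (s i).1) (hN := le_rfl)
      (((ht ⟨p.1, hle i p.2.1, p.2.2⟩).res (inf_le_inf_right _ (hle i))).congr le_rfl
        fun q hV hW hq => (hx₀ i q hW hV hq).symm) ((s i).2.2 p) fun hps hp => ?_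
    -- The extension was made from the chosen member through `p`; near `p` it is compared with
    -- member `i` on their overlap.
    refine ⟨(U i ⊓ U (c p.1 (hle i p.2.1))) ⊓ 𝔖.chartNhd p.1, inf_le_inf_right _ inf_le_left,
      ⟨⟨p.2.1, hpc⟩, 𝔖.mem_chartNhd _⟩, ?_⟩
    rw [hs2 i (c p.1 (hle i p.2.1)) p.1 p.2.1 hpc p.2.2, ← htc ⟨p.1, hle i p.2.1, p.2.2⟩,
      ModPresheaf.res_res]
    exact ModPresheaf.res_res _ _ _ _
  · have h1 := congrFun (congrArg (fun z => z.1.1) (hy (c q.1 q.2.1))) ⟨q.1, hc q.1 q.2.1, q.2.2⟩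
    exact h1
  · have h1 := congrFun (congrArg (fun z => z.1.2) (hy (c p.1 p.2.1))) ⟨p.1, hc p.1 p.2.1, p.2.2⟩
    -- For uniqueness at `p`: the component of `y` describes the same values as that of `x`, and
    -- both restrict to the given section over the chosen member.
    have h2 : 𝔖.InChart x.1 p.1 ((⨆ i, U i) ⊓ 𝔖.chartNhd p.1) le_rfl (y.1.2 p) :=
      (y.2.2 p).congr _ fun q hq _ hqs =>
        congrFun (congrArg (fun z => z.1.1) (hy (c q hq))) ⟨q, hc q hq, hqs⟩
    refine h2.eq (x.2.2 p) fun _ _ => ⟨U (c p.1 p.2.1) ⊓ 𝔖.chartNhd p.1, inf_le_inf_right _ (hle _),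
      ⟨hc p.1 p.2.1, 𝔖.mem_chartNhd _⟩, ?_⟩
    exact h1.trans (htc p).symm

end TameSettlement

/-! ### Differentials of a ring -/

namespace Differentials

variable {R : Type w} [Ring R] [Algebra ℂ R] {chain : Set (R × List (R × R))}

/-- The bimodule homomorphism from the differentials induced by a map that respects the
relations. -/
theorem exists_lift {X : Type*} [AddCommGroup X] [Module (Env R) X] (D : R → X)
    (hD : ∀ x, DiffRel chain x → Finsupp.linearCombination (Env R) D x = 0) :
    ∃ Φ : Differentials R chain →ₗ[Env R] X, ∀ r, Φ (d r) = D r := by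
  let S := Submodule.span (Env R) {x : R →₀ Env R | DiffRel chain x}
  have hS : S ≤ LinearMap.ker (Finsupp.linearCombination (Env R) D) :=
    Submodule.span_le.2 fun x hx => hD x hx
  refine ⟨S.liftQ _ hS, fun r => ?_⟩
  show S.liftQ _ hS (S.mkQ (symb r)) = D r
  rw [Submodule.mkQ_apply, Submodule.liftQ_apply, symb, Finsupp.linearCombination_single, one_smul]

theorem mkQ_eq_zero {x : R →₀ Env R} (hx : DiffRel chain x) :
    (Submodule.span (Env R) {x | DiffRel chain x}).mkQ x = 0 :=
  (Submodule.Quotient.mk_eq_zero _).2 (Submodule.subset_span hx)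

variable (chain) in
/-- The canonical projection onto the differentials. -/
def proj : (R →₀ Env R) →ₗ[Env R] Differentials R chain :=
  (Submodule.span (Env R) {x | DiffRel chain x}).mkQ

theorem proj_lmul (a : R) (x : R →₀ Env R) : proj chain (lmul a x) = lmul a (proj chain x) :=
  map_smul _ _ _

theorem proj_rmul (x : R →₀ Env R) (a : R) : proj chain (rmul x a) = rmul (proj chain x) a :=
  map_smul _ _ _

theorem d_linear (a b : ℂ) (r s : R) : (d (a • r + b • s) : Differentials R chain) =
    lmul (algebraMap ℂ R a) (d r) + lmul (algebraMap ℂ R b) (d s) := by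
  have h : proj chain _ = 0 := mkQ_eq_zero (DiffRel.linear_left a b r s)
  rwa [map_sub, map_add, proj_lmul, proj_lmul, sub_eq_zero] at h

theorem d_mul (r s : R) : (d (r * s) : Differentials R chain) = rmul (d r) s + lmul r (d s) := by
  have h : proj chain _ = 0 := mkQ_eq_zero (DiffRel.leibniz r s)
  rwa [map_sub, map_add, proj_lmul, proj_rmul, sub_eq_zero] at h

theorem d_chain {y : R} {l : List (R × R)} (hl : (y, l) ∈ chain) :
    (d y : Differentials R chain) = (l.map fun ar => lmul ar.1 (d ar.2)).sum := by
  have h : proj chain _ = 0 := mkQ_eq_zero (DiffRel.chain y l hl)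
  rw [map_sub, sub_eq_zero, map_list_sum, List.map_map] at h
  refine Eq.trans h (congrArg List.sum (List.map_congr_left fun ar _ => ?_))
  exact proj_lmul _ _

/-- A derivation of a `ℂ`-algebra that satisfies the chain rule factors over the differentials. -/
theorem exists_lift_derivation (D : R → R)
    (hlin : ∀ (a b : ℂ) (r s : R), D (a • r + b • s) = a • D r + b • D s)
    (hmul : ∀ r s, D (r * s) = D r * s + r * D s)
    (hchain : ∀ y l, (y, l) ∈ chain → D y = (l.map fun ar => ar.1 * D ar.2).sum) :
    ∃ Φ : Differentials R chain →+ R, (∀ r, Φ (d r) = D r) ∧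
      (∀ a x, Φ (lmul a x) = a * Φ x) ∧ ∀ a x, Φ (rmul x a) = Φ x * a := by
  -- `R` is a bimodule over itself by left and right multiplication.
  let : Module (Env R) R := TensorProduct.Algebra.module
  have hl : ∀ a x : R, lmul a x = a * x := fun a x => by
    show (a ⊗ₜ[ℤ] (1 : Rᵐᵒᵖ) : Env R) • x = _
    rw [TensorProduct.Algebra.smul_def, one_smul, smul_eq_mul]
  have hr : ∀ a x : R, rmul x a = x * a := fun a x => by
    show ((1 : R) ⊗ₜ[ℤ] MulOpposite.op a : Env R) • x = _
    rw [TensorProduct.Algebra.smul_def, one_smul, op_smul_eq_mul]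
  let L := Finsupp.linearCombination (Env R) D
  have Ls : ∀ r, L (symb r) = D r := fun r => by
    rw [symb, Finsupp.linearCombination_single, one_smul]
  have Ll : ∀ a x, L (lmul a x) = a * L x := fun a x => (map_smul L _ _).trans (hl _ _)
  have Lr : ∀ a x, L (rmul x a) = L x * a := fun a x => (map_smul L _ _).trans (hr _ _)
  obtain ⟨Φ, hΦ⟩ := exists_lift (chain := chain) D (fun x hx => by
    change L x = 0
    induction hx with
    | linear_left a b r s =>
      rw [map_sub, map_add, Ll, Ll, Ls, Ls, Ls, hlin, Algebra.smul_def, Algebra.smul_def, sub_self]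
    | linear_right a b r s =>
      rw [map_sub, map_add, Lr, Lr, Ls, Ls, Ls, hlin, Algebra.smul_def, Algebra.smul_def,
        Algebra.commutes, Algebra.commutes, sub_self]
    | leibniz r s => rw [map_sub, map_add, Ll, Lr, Ls, Ls, Ls, hmul, sub_self]
    -- Centrality of `z` suffices here; the value of `D` on `z` plays no role.
    | center r z hz =>
      rw [map_sub, Ll, Lr, Ls, Subring.mem_center_iff.1 hz, sub_self]
    | chain y l hl =>
      rw [map_sub, Ls, hchain y l hl, map_list_sum, List.map_map, sub_eq_zero]
      refine congrArg List.sum (List.map_congr_left fun ar _ => ?_)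
      rw [Function.comp_apply, Ll, Ls])
  exact ⟨Φ.toAddMonoidHom, hΦ, fun a x => (map_smul Φ _ _).trans (hl _ _),
    fun a x => (map_smul Φ _ _).trans (hr _ _)⟩

end Differentials

namespace ModPresheaf

variable {M : MildlySingularManifold n Y} {F : ModPresheaf.{u, v} M}

/-! ### The endomorphism sheaf of a sheaf -/

/-- The action of a section of the endomorphism sheaf over a smaller open set. -/
def End.app {U : Opens Y} (φ : F.End U) (V : Opens Y) (hV : V ≤ U) :
    F.sec V →ₗ[M.smoothC V] F.sec V := φ.1 ⟨V, hV⟩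

theorem End.ext {U : Opens Y} {φ ψ : F.End U}
    (h : ∀ (V : Opens Y) (hV : V ≤ U) (s : F.sec V), φ.app V hV s = ψ.app V hV s) : φ = ψ :=
  Subtype.ext (funext fun V => LinearMap.ext (h V.1 V.2))

theorem End.res_app {U : Opens Y} (φ : F.End U) {V W : Opens Y} (hV : V ≤ U) (h : W ≤ V)
    (s : F.sec V) : F.res h (φ.app V hV s) = φ.app W (h.trans hV) (F.res h s) :=
  φ.2 ⟨V, hV⟩ ⟨W, h.trans hV⟩ h s

theorem End.app_endRes {U V : Opens Y} (h : V ≤ U) (φ : F.End U) (W : Opens Y) (hW : W ≤ V) :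
    (F.endRes h φ).app W hW = φ.app W (hW.trans h) := rfl

theorem IsSheaf.end_eq_of_locally (hF : F.IsSheaf) {U : Opens Y} {φ ψ : F.End U}
    (h : ∀ q ∈ U, ∃ (N : Opens Y) (hN : N ≤ U), q ∈ N ∧ F.endRes hN φ = F.endRes hN ψ) :
    φ = ψ := End.ext fun V hV s => hF.eq_of_locally fun q hq => by
  obtain ⟨N, hN, hqN, h⟩ := h q (hV hq)
  refine ⟨V ⊓ N, inf_le_left, ⟨hq, hqN⟩, ?_⟩
  rw [End.res_app, End.res_app, ← End.app_endRes hN φ _ inf_le_right, h, End.app_endRes]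

/-- The glued endomorphism sends `s` over `V` to the section that is `φ i` of the restriction of `s`
on each `V ⊓ N i`. Uniqueness of this section yields linearity, compatibility with restriction and
the value on each `N i`. -/
theorem IsSheaf.end_exists_glue (hF : F.IsSheaf) {ι : Type u} {U : Opens Y} {N : ι → Opens Y}
    (hN : ∀ i, N i ≤ U) (hU : ∀ q ∈ U, ∃ i, q ∈ N i) (φ : ∀ i, F.End (N i))
    (hφ : ∀ i j, F.endRes (inf_le_left : N i ⊓ N j ≤ N i) (φ i) =
      F.endRes (inf_le_right : N i ⊓ N j ≤ N j) (φ j)) :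
    ∃ ψ : F.End U, ∀ i, F.endRes (hN i) ψ = φ i := by
  have hφ' : ∀ i j (V : Opens Y) (hi : V ≤ N i) (hj : V ≤ N j),
      (φ i).app V hi = (φ j).app V hj := fun i j V hi hj => by
    rw [← End.app_endRes inf_le_left (φ i) V (le_inf hi hj), hφ, End.app_endRes]
  have hglue : ∀ (V : Iic U) (s : F.sec V.1), ∃ t : F.sec V.1, ∀ i,
      F.res (inf_le_left : V.1 ⊓ N i ≤ V.1) t =
        (φ i).app (V.1 ⊓ N i) inf_le_right (F.res inf_le_left s) := fun V s => by
    refine hF.exists_glue (fun i => inf_le_left)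
      (fun q hq => (hU q (V.2 hq)).imp fun i hi => ⟨hq, hi⟩)
      (fun i => (φ i).app (V.1 ⊓ N i) inf_le_right (F.res inf_le_left s)) fun i j => ?_
    rw [End.res_app, End.res_app, F.res_res, F.res_res, hφ' i j]
  choose T hT using hglue
  have huniq : ∀ (V : Iic U) (s t : F.sec V.1), (∀ i, F.res (inf_le_left : V.1 ⊓ N i ≤ V.1) t =
      (φ i).app (V.1 ⊓ N i) inf_le_right (F.res inf_le_left s)) → T V s = t := fun V s t ht =>
    hF.eq_of_locally fun q hq => by
      obtain ⟨i, hi⟩ := hU q (V.2 hq)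
      exact ⟨V.1 ⊓ N i, inf_le_left, ⟨hq, hi⟩, by rw [hT, ht]⟩
  refine ⟨⟨fun V => ⟨⟨T V, fun s t => huniq V _ _ fun i => ?_⟩, fun f s => huniq V _ _ fun i => ?_⟩,
    fun V W h s => Eq.symm (huniq W _ _ fun i => ?_)⟩,
    fun i => End.ext fun V hV s => huniq ⟨V, hV.trans (hN i)⟩ s _ fun j => ?_⟩
  · rw [map_add, hT, hT, map_add, map_add]
  · rw [RingHom.id_apply, F.res_smul, hT, F.res_smul, map_smul]
  · show F.res _ (F.res h (T V s)) = _
    have h1 : W.1 ⊓ N i ≤ V.1 ⊓ N i := inf_le_inf_right _ h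
    rw [F.res_res, ← F.res_res inf_le_left h1, hT, End.res_app, F.res_res, F.res_res]
  · rw [End.res_app, hφ' i j]

theorem germ_eq_iff {U V : Opens Y} {q : Y} (hU : q ∈ U) (hV : q ∈ V) {φ : F.End U}
    {ψ : F.End V} : F.germ U q hU φ = F.germ V q hV ψ ↔
      ∃ (N : Opens Y) (h : N ≤ U) (h' : N ≤ V), q ∈ N ∧ F.endRes h φ = F.endRes h' ψ := by
  constructor
  · intro h
    obtain ⟨N, hN, hN', h⟩ := Quotient.exact h
    exact ⟨(OrderDual.ofDual N).toOpens, hN, hN', (OrderDual.ofDual N).mem, h⟩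
  · rintro ⟨N, h, h', hq, e⟩
    rw [← F.germ_endRes h q hq, e, F.germ_endRes]

theorem exists_germ_eq {q : Y} (x : F.Stalk q) :
    ∃ (N : Opens Y) (hq : q ∈ N) (φ : F.End N), F.germ N q hq φ = x := by
  obtain ⟨⟨N, φ⟩, rfl⟩ := Quotient.exists_rep x
  exact ⟨(OrderDual.ofDual N).toOpens, (OrderDual.ofDual N).mem, φ, rfl⟩

/-- Germs can be represented on a common neighbourhood inside a given one. -/
theorem exists_germ_eq₂ {U : Opens Y} {q : Y} (hq : q ∈ U) (x y : F.Stalk q) :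
    ∃ (N : Opens Y) (_ : N ≤ U) (hqN : q ∈ N) (φ ψ : F.End N),
      F.germ N q hqN φ = x ∧ F.germ N q hqN ψ = y := by
  obtain ⟨A, hA, φ, rfl⟩ := exists_germ_eq x
  obtain ⟨B, hB, ψ, rfl⟩ := exists_germ_eq y
  exact ⟨U ⊓ (A ⊓ B), inf_le_left, ⟨hq, hA, hB⟩,
    F.endRes (inf_le_right.trans inf_le_left) φ, F.endRes (inf_le_right.trans inf_le_right) ψ,
    F.germ_endRes _ _ _ _, F.germ_endRes _ _ _ _⟩

theorem germ_smul {U : Opens Y} {q : Y} (hq : q ∈ U) (c : ℂ) (φ : F.End U) :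
    F.germ U q hq (c • φ) = c • F.germ U q hq φ :=
  (DirectLimit.smul_def (G := F.EndAt q) (f := F.endAtRes q) (OrderDual.toDual (⟨U, hq⟩ : OpenNhdsOf q)) φ c).symm

theorem algebraMap_stalk {U : Opens Y} {q : Y} (hq : q ∈ U) (c : ℂ) :
    algebraMap ℂ (F.Stalk q) c = F.germ U q hq (algebraMap ℂ (F.End U) c) := by
  rw [Algebra.algebraMap_eq_smul_one, Algebra.algebraMap_eq_smul_one, germ_smul, map_one]

theorem IsSheaf.end_eq_of_germ (hF : F.IsSheaf) {U : Opens Y} {φ ψ : F.End U}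
    (h : ∀ q hq, F.germ U q hq φ = F.germ U q hq ψ) : φ = ψ :=
  hF.end_eq_of_locally fun q hq => by
    obtain ⟨N, hN, _, hqN, e⟩ := (germ_eq_iff hq hq).1 (h q hq)
    exact ⟨N, hN, hqN, e⟩

/-- A family of germs that is locally given by sections is given by a section. -/
theorem IsSheaf.end_exists_of_germ (hF : F.IsSheaf) {U : Opens Y} (x : ∀ q : U, F.Stalk q.1)
    (hx : ∀ q : U, ∃ (N : Opens Y) (_ : q.1 ∈ N) (hN : N ≤ U) (φ : F.End N),
      ∀ (r : Y) (hr : r ∈ N), x ⟨r, hN hr⟩ = F.germ N r hr φ) :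
    ∃ ψ : F.End U, ∀ q : U, F.germ U q.1 q.2 ψ = x q := by
  choose N hqN hN φ hφ using hx
  obtain ⟨ψ, hψ⟩ := hF.end_exists_glue hN (fun q hq => ⟨⟨q, hq⟩, hqN _⟩) φ fun i j =>
    hF.end_eq_of_germ fun q hq => by
      rw [F.germ_endRes, F.germ_endRes, ← hφ i q hq.1, ← hφ j q hq.2]
  exact ⟨ψ, fun q => by rw [← F.germ_endRes (hN q) q.1 (hqN q), hψ, ← hφ]⟩

end ModPresheaf

namespace ModPresheaf

variable {M : MildlySingularManifold n Y} {F : ModPresheaf.{u, v} M}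

/-! ### Evaluation of tangent sections on cotangent sections -/

/-- Compatibility with restriction makes the germ of `D φ` depend only on the germ of `φ`.
Representatives are taken inside `U`, where `D` is defined. -/
theorem IsDerivation.exists_stalkMap {U : Opens Y} {D : F.LocalMaps (fun V => F.End V) U}
    (hD : F.IsDerivation D) {q : Y} (hq : q ∈ U) :
    ∃ δ : F.Stalk q → F.Stalk q, ∀ (N : Iic U) (hN : q ∈ N.1) (φ : F.End N.1),
      δ (F.germ N.1 q hN φ) = F.germ N.1 q hN (D N φ) := by
  have h : ∀ x : F.Stalk q, ∃ (N : Iic U) (hN : q ∈ N.1) (φ : F.End N.1),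
      F.germ N.1 q hN φ = x := fun x => by
    obtain ⟨N, hNU, hqN, φ, -, h, -⟩ := exists_germ_eq₂ hq x x
    exact ⟨⟨N, hNU⟩, hqN, φ, h⟩
  choose N hN φ hφ using h
  refine ⟨fun x => F.germ (N x).1 q (hN x) (D (N x) (φ x)), fun A hA ψ => ?_⟩
  obtain ⟨W, h1, h2, hqW, e⟩ := (germ_eq_iff (hN _) hA).1 (hφ (F.germ A.1 q hA ψ))
  have hWU : W ≤ U := h2.trans A.2
  refine (germ_eq_iff _ _).2 ⟨W, h1, h2, hqW, ?_⟩
  rw [hD.map_res _ ⟨W, hWU⟩ h1, hD.map_res _ ⟨W, hWU⟩ h2, e]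

/-- The induced map of the stalk inherits the rules of `ξ`, since finitely many germs have
representatives on a common neighbourhood in `U`; the universal property of the differentials then
applies. -/
theorem exists_stalk_evaluation {U : Opens Y} (ξ : F.tangent U) {q : Y} (hq : q ∈ U) :
    ∃ Φ : F.CotStalk q →+ F.Stalk q, (∀ (N : Iic U) (hN : q ∈ N.1) (φ : F.End N.1),
        Φ (Differentials.d (F.germ N.1 q hN φ)) = F.germ N.1 q hN (ξ.1 N φ)) ∧
      (∀ a x, Φ (lmul a x) = a * Φ x) ∧ ∀ a x, Φ (rmul x a) = Φ x * a := by
  obtain ⟨hD, hC⟩ := ξ.2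
  obtain ⟨δ, hδ⟩ := hD.exists_stalkMap hq
  obtain ⟨Φ, h1, h2⟩ := Differentials.exists_lift_derivation (chain := F.stalkChain q) δ
    (fun a b r s => by
      obtain ⟨N, hNU, hqN, φ, ψ, rfl, rfl⟩ := exists_germ_eq₂ hq r s
      rw [← germ_smul, ← germ_smul, ← map_add, hδ ⟨N, hNU⟩, hδ ⟨N, hNU⟩, hδ ⟨N, hNU⟩,
        hD.map_linear, map_add, germ_smul, germ_smul])
    (fun r s => by
      obtain ⟨N, hNU, hqN, φ, ψ, rfl, rfl⟩ := exists_germ_eq₂ hq r s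
      rw [← map_mul, hδ ⟨N, hNU⟩, hδ ⟨N, hNU⟩, hδ ⟨N, hNU⟩, hD.leibniz, map_add, map_mul, map_mul])
    (fun y l hl => by
      obtain ⟨W, hqW, s, h, hh, f, e⟩ := hl
      obtain ⟨rfl, rfl⟩ := Prod.mk.inj e
      -- The functions of a chain relation live on some `W` that need not lie in `U`, so they are
      -- restricted before the chain rule of `ξ` is used.
      let N : Iic U := ⟨W ⊓ U, (inf_le_right : W ⊓ U ≤ U)⟩
      have hqN : q ∈ N.1 := ⟨hqW, hq⟩
      have hNW : N.1 ≤ W := inf_le_left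
      let f' : Fin s → M.smooth N.1 := fun i => ⟨fun x => (f i).1 ⟨x, hNW x.2⟩, (f i).2.mono hNW⟩
      have hres : ∀ g : M.smoothC W, F.germ W q hqW (F.scalar W g) =
          F.germ N.1 q hqN (F.scalar N.1 (M.restrict hNW g)) := fun g =>
        (F.germ_endRes hNW q hqN (F.scalar W g)).symm
      rw [List.map_ofFn, List.sum_ofFn, hres, hδ]
      refine (congrArg _ (hC N s h hh f')).trans ?_
      rw [map_sum]
      refine Finset.sum_congr rfl fun i _ => ?_
      rw [map_mul, Function.comp_apply, hres, hres, hδ]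
      rfl)
  exact ⟨Φ, fun N hN φ => (h1 _).trans (hδ N hN φ), h2⟩

theorem cotangent_smul_apply {U : Opens Y} (a : F.End U) (θ : F.cotangent U) (q : U) :
    (a • θ).1 q = lmul (F.germ U q.1 q.2 a) (θ.1 q) := rfl

theorem cotangent_op_smul_apply {U : Opens Y} (a : F.End U) (θ : F.cotangent U) (q : U) :
    (MulOpposite.op a • θ).1 q = rmul (θ.1 q) (F.germ U q.1 q.2 a) := rfl

theorem cotRes_d {U V : Opens Y} (h : V ≤ U) (a : F.End U) :
    F.cotRes h (F.d a) = F.d (F.endRes h a) :=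
  Subtype.ext (funext fun q =>
    congrArg (Differentials.d (chain := F.stalkChain q.1)) (F.germ_endRes h q.1 q.2 a).symm)

/-- The value of a section of the cotangent sheaf in the stalk. -/
def cotEval {U : Opens Y} (q : U) : F.cotangent U →+ F.CotStalk q.1 where
  toFun θ := θ.1 q
  map_zero' := rfl
  map_add' _ _ := rfl

/-- This turns the stalkwise local form into an equality of sections, to which a bimodule
homomorphism can be applied. -/
theorem cotangent_locally {U : Opens Y} (θ : F.cotangent U) (q : U) :
    ∃ (N : Opens Y) (_ : q.1 ∈ N) (hN : N ≤ U) (l : List (F.End N × F.End N × F.End N)),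
      F.cotRes hN θ = (l.map fun t => t.1 • MulOpposite.op t.2.2 • F.d t.2.1).sum := by
  obtain ⟨N, hqN, hN, l, hl⟩ := θ.2 q
  refine ⟨N, hqN, hN, l, Subtype.ext (funext fun r => (hl r.1 r.2).trans ?_)⟩
  show _ = cotEval r _
  rw [map_list_sum, List.map_map]
  rfl

theorem d_linear {U : Opens Y} (c c' : ℂ) (a b : F.End U) : F.d (c • a + c' • b) =
    algebraMap ℂ (F.End U) c • F.d a + algebraMap ℂ (F.End U) c' • F.d b :=
  Subtype.ext (funext fun q => by
    show Differentials.d _ = lmul _ (Differentials.d _) + lmul _ (Differentials.d _)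
    rw [map_add, germ_smul, germ_smul, Differentials.d_linear, algebraMap_stalk q.2,
      algebraMap_stalk q.2])

theorem d_mul {U : Opens Y} (a b : F.End U) :
    F.d (a * b) = MulOpposite.op b • F.d a + a • F.d b :=
  Subtype.ext (funext fun q => by
    show Differentials.d _ = rmul (Differentials.d _) _ + lmul _ (Differentials.d _)
    rw [map_mul, Differentials.d_mul]
    rfl)

theorem d_chain {U : Opens Y} {s : ℕ} (h : (Fin s → ℝ) → ℝ) (hh : ContDiff ℝ ∞ h)
    (f : Fin s → M.smooth U) : F.d (F.scalar U (M.ofReal (M.compose h hh f))) =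
      ∑ i, F.scalar U (M.ofReal (M.compose (MildlySingularManifold.partialDeriv h i)
        (MildlySingularManifold.contDiff_partialDeriv hh i) f)) •
        F.d (F.scalar U (M.ofReal (f i))) :=
  Subtype.ext (funext fun q => by
    refine (Differentials.d_chain (chain := F.stalkChain q.1) ⟨U, q.2, s, h, hh, f, rfl⟩).trans ?_
    rw [List.map_ofFn, List.sum_ofFn]
    show _ = cotEval q _
    rw [map_sum]
    rfl)

/-- A section of the sheaf of bimodule homomorphisms as an additive map. -/
def biHomApp {U : Opens Y} (Φ : F.biHom U) (V : Iic U) : F.cotangent V.1 →+ F.End V.1 :=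
  AddMonoidHom.mk' (Φ.1 V) (Φ.2.2.1 V)

/-- The derivation `b ↦ Φ (db)` of a bimodule homomorphism. -/
def toTangent (U : Opens Y) : F.biHom U →ₗ[M.smoothC U] F.tangent U where
  toFun Φ := ⟨fun V b => Φ.1 V (F.d b), by
    obtain ⟨hres, hadd, hl, hr⟩ := Φ.2
    refine ⟨⟨fun V W h a => ?_, fun V c c' a b => ?_, fun V a b => ?_⟩, fun V s h hh f => ?_⟩
    · rw [hres V W h, cotRes_d]
    · rw [d_linear, hadd, hl, hl, Algebra.smul_def, Algebra.smul_def]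
    · rw [d_mul, hadd, hl, hr]
    · refine (congrArg (biHomApp Φ V) (d_chain h hh f)).trans ?_
      refine (map_sum (biHomApp Φ V) _ _).trans (Finset.sum_congr rfl fun i _ => ?_)
      exact hl V _ _⟩
  map_add' _ _ := rfl
  map_smul' _ _ := rfl

theorem toTangent_apply {U : Opens Y} (Φ : F.biHom U) (V : Iic U) (b : F.End V.1) :
    (toTangent U Φ).1 V b = Φ.1 V (F.d b) := rfl

theorem biHom_apply {U : Opens Y} (Φ : F.biHom U) (V : Iic U) (a b c : F.End V.1) :
    Φ.1 V (a • MulOpposite.op c • F.d b) = a * (toTangent U Φ).1 V b * c := by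
  rw [Φ.2.2.2.1, Φ.2.2.2.2, mul_assoc]
  rfl

/-- The terms `a (db) c` generate the cotangent sheaf locally, and sections of the endomorphism
sheaf that agree locally are equal. -/
theorem IsSheaf.toTangent_injective (hF : F.IsSheaf) (U : Opens Y) :
    Function.Injective (toTangent (F := F) U) := fun Φ Ψ h => by
  refine Subtype.ext (funext fun V => funext fun θ => hF.end_eq_of_locally fun q hq => ?_)
  obtain ⟨N, hqN, hN, l, hl⟩ := cotangent_locally θ ⟨q, hq⟩
  refine ⟨N, hN, hqN, ?_⟩
  let N' : Iic U := ⟨N, hN.trans V.2⟩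
  rw [Φ.2.1 V N' hN, Ψ.2.1 V N' hN, hl]
  refine (map_list_sum (biHomApp Φ N') _).trans
    (Eq.trans ?_ (map_list_sum (biHomApp Ψ N') _).symm)
  rw [List.map_map, List.map_map]
  refine congrArg List.sum (List.map_congr_left fun t _ => ?_)
  exact (biHom_apply Φ N' _ _ _).trans (h ▸ (biHom_apply Ψ N' _ _ _).symm)

/-- The preimage of `ξ` applies the stalk evaluations `E` to a cotangent section and glues the
resulting germs; all its properties are then checked on germs. -/
theorem IsSheaf.toTangent_surjective (hF : F.IsSheaf) (U : Opens Y) :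
    Function.Surjective (toTangent (F := F) U) := fun ξ => by
  choose E hE hEl hEr using fun q : U => exists_stalk_evaluation ξ q.2
  have hex : ∀ (V : Iic U) (θ : F.cotangent V.1), ∃ ψ : F.End V.1,
      ∀ q : V.1, F.germ V.1 q.1 q.2 ψ = E ⟨q.1, V.2 q.2⟩ (θ.1 q) := fun V θ => by
    refine hF.end_exists_of_germ (fun q => E ⟨q.1, V.2 q.2⟩ (θ.1 q)) fun q => ?_
    obtain ⟨N, hqN, hN, l, hl⟩ := θ.2 q
    let N' : Iic U := ⟨N, hN.trans V.2⟩
    -- Where `θ = ∑ a (db) c`, the section `∑ a (ξ b) c` has the required germ at every point of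
    -- `N`.
    refine ⟨N, hqN, hN, (l.map fun t => t.1 * ξ.1 N' t.2.1 * t.2.2).sum, fun r hr => ?_⟩
    dsimp only
    rw [hl r hr, map_list_sum, map_list_sum, List.map_map, List.map_map]
    refine congrArg List.sum (List.map_congr_left fun t _ => ?_)
    have h1 := hE ⟨r, V.2 (hN hr)⟩ N' hr t.2.1
    rw [Function.comp_apply, Function.comp_apply, hEl, hEr, map_mul, map_mul, mul_assoc, h1]
  choose T hT using hex
  refine ⟨⟨fun V θ => T V θ, fun V W h θ => ?_, fun V θ η => ?_, fun V a θ => ?_,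
    fun V a θ => ?_⟩, Subtype.ext (funext fun V => funext fun b => ?_)⟩
  · refine hF.end_eq_of_germ fun q hq => ?_
    rw [F.germ_endRes, hT V θ ⟨q, h hq⟩, hT W _ ⟨q, hq⟩]
    rfl
  · refine hF.end_eq_of_germ fun q hq => ?_
    rw [map_add, hT V _ ⟨q, hq⟩, hT V _ ⟨q, hq⟩, hT V _ ⟨q, hq⟩, ← map_add]
    rfl
  · refine hF.end_eq_of_germ fun q hq => ?_
    rw [map_mul, hT V _ ⟨q, hq⟩, hT V _ ⟨q, hq⟩, cotangent_smul_apply, hEl]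
  · refine hF.end_eq_of_germ fun q hq => ?_
    rw [map_mul, hT V _ ⟨q, hq⟩, hT V _ ⟨q, hq⟩, cotangent_op_smul_apply, hEr]
  · refine hF.end_eq_of_germ fun q hq => ?_
    rw [toTangent_apply]
    exact (hT V _ ⟨q, hq⟩).trans (hE ⟨q, V.2 hq⟩ V hq b)

/-- Tangent sections are the bimodule homomorphisms from the cotangent sheaf. -/
def tangentEquiv (hF : F.IsSheaf) (U : Opens Y) : F.tangent U ≃ₗ[M.smoothC U] F.biHom U :=
  (LinearEquiv.ofBijective (toTangent U)
    ⟨hF.toTangent_injective U, hF.toTangent_surjective U⟩).symm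

theorem toTangent_tangentEquiv (hF : F.IsSheaf) {U : Opens Y} (ξ : F.tangent U) :
    toTangent U (tangentEquiv hF U ξ) = ξ :=
  (LinearEquiv.ofBijective (toTangent U)
    ⟨hF.toTangent_injective U, hF.toTangent_surjective U⟩).apply_symm_apply ξ

/-- The inverse `toTangent` commutes with restriction by definition, and it is injective. -/
theorem tangentEquiv_tanRes (hF : F.IsSheaf) {U V : Opens Y} (h : V ≤ U) (ξ : F.tangent U) :
    tangentEquiv hF V (F.tanRes h ξ) = F.biHomRes h (tangentEquiv hF U ξ) :=
  hF.toTangent_injective V ((toTangent_tangentEquiv hF _).trans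
    (congrArg (F.tanRes h) (toTangent_tangentEquiv hF ξ)).symm)

theorem tangentEquiv_apply (hF : F.IsSheaf) {U : Opens Y} (ξ : F.tangent U) (V : Iic U)
    (a b c : F.End V.1) :
    (tangentEquiv hF U ξ).1 V (a • MulOpposite.op c • F.d b) = a * ξ.1 V b * c := by
  rw [biHom_apply, toTangent_tangentEquiv]

theorem biHom_smul_apply {U : Opens Y} (f : M.smoothC U) (Φ : F.biHom U) (θ : F.cotangent U) :
    (f • Φ).1 ⟨U, le_refl U⟩ θ = f • Φ.1 ⟨U, le_refl U⟩ θ :=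
  (Algebra.smul_def f (Φ.1 ⟨U, le_refl U⟩ θ : F.End U)).symm

theorem biHom_apply_smul {U : Opens Y} (Φ : F.biHom U) (f : M.smoothC U) (θ : F.cotangent U) :
    Φ.1 ⟨U, le_refl U⟩ (f • θ) = f • Φ.1 ⟨U, le_refl U⟩ θ :=
  (Φ.2.2.2.1 ⟨U, le_refl U⟩ (F.scalar U f) θ).trans
    (Algebra.smul_def f (Φ.1 ⟨U, le_refl U⟩ θ : F.End U)).symm

/-- The pairing of the tangent and the cotangent sheaf. -/
def pairing (hF : F.IsSheaf) (U : Opens Y) :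
    F.tangent U ⊗[M.smoothC U] F.cotangent U →ₗ[M.smoothC U] F.End U :=
  TensorProduct.lift (LinearMap.mk₂ (M.smoothC U)
    (fun ξ θ => (tangentEquiv hF U ξ).1 ⟨U, le_refl U⟩ θ)
    (fun ξ ξ' θ => by rw [map_add]; rfl)
    (fun f ξ θ => (congrArg (fun Φ : F.biHom U => Φ.1 ⟨U, le_refl U⟩ θ)
      ((tangentEquiv hF U).map_smul f ξ)).trans (biHom_smul_apply f _ θ))
    (fun ξ θ η => (tangentEquiv hF U ξ).2.2.1 ⟨U, le_refl U⟩ θ η)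
    (fun f ξ θ => biHom_apply_smul _ f θ))

theorem pairing_tmul (hF : F.IsSheaf) {U : Opens Y} (ξ : F.tangent U) (θ : F.cotangent U) :
    pairing hF U (ξ ⊗ₜ θ) = (tangentEquiv hF U ξ).1 ⟨U, le_refl U⟩ θ := rfl

/-! ### The chain rule at smooth points -/

/-- Evaluation of endomorphisms on a section. -/
def End.evalAt {U : Opens Y} (V : Opens Y) (hV : V ≤ U) (s : F.sec V) : F.End U →+ F.sec V where
  toFun φ := φ.app V hV s
  map_zero' := rfl
  map_add' _ _ := rfl

theorem IsDerivation.map_algebraMap {U : Opens Y} {D : F.LocalMaps (fun V => F.End V) U}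
    (hD : F.IsDerivation D) (V : Iic U) (c : ℂ) : D V (algebraMap ℂ (F.End V.1) c) = 0 := by
  have h1 : D V 1 = 0 := by simpa using hD.leibniz V 1 1
  simpa [Algebra.algebraMap_eq_smul_one, h1] using hD.map_linear V c 0 1 0

/-- A derivation of the endomorphism sheaf satisfies the chain rule if sections are determined by
their values at the points. -/
theorem IsDerivation.satisfiesChainRule {U : Opens Y} {D : F.LocalMaps (fun V => F.End V) U}
    (hD : F.IsDerivation D)
    (hF : ∀ V ≤ U, ∀ t : F.sec V, (∀ (q : Y) (hq : q ∈ V),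
      t ∈ M.idealAt V q hq • (⊤ : Submodule (M.smoothC V) (F.sec V))) → t = 0) :
    F.SatisfiesChainRule D := by
  intro V s h hh f
  let D' : F.End V.1 →+ F.End V.1 := AddMonoidHom.mk' (D V) fun a b => by
    simpa using hD.map_linear V 1 1 a b
  -- `δ` is `D` restricted to functions, a derivation with values in endomorphisms.
  let δ : M.smoothC V.1 →+ F.End V.1 := D'.comp (F.scalar V.1).toAddMonoidHom
  have hmul : ∀ a b, δ (a * b) = δ a * F.scalar V.1 b + F.scalar V.1 a * δ b := fun a b => by
    show D V (F.scalar V.1 (a * b)) = _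
    rw [map_mul, hD.leibniz]
    rfl
  have hconst : ∀ c : ℂ, δ (algebraMap ℂ _ c) = 0 := hD.map_algebraMap V
  rw [← sub_eq_zero]
  refine End.ext fun W hW t => hF W (hW.trans V.2) _ fun q hq => ?_
  -- By `hF` it is enough to work at one point `q` at a time, so the Taylor expansion may be centred
  -- at `f(q)` and depend on `q`.
  obtain ⟨g, hg, hg0, hgh⟩ := MildlySingularManifold.exists_hadamard hh fun i => (f i).1 ⟨q, hW hq⟩
  have hexp : M.ofReal (M.compose h hh f) =
      algebraMap ℂ _ (h (fun i => (f i).1 ⟨q, hW hq⟩) : ℂ) +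
      ∑ i, M.ofReal (M.compose (g i) (hg i) f) *
        (M.ofReal (f i) - algebraMap ℂ _ ((f i).1 ⟨q, hW hq⟩ : ℂ)) := by
    refine Subtype.ext (funext fun x => ?_)
    have h1 := congrArg (fun r : ℝ => (r : ℂ)) (hgh fun i => (f i).1 x)
    rw [Subalgebra.coe_add, Pi.add_apply, AddSubmonoidClass.coe_finsetSum, Finset.sum_apply]
    push_cast at h1
    exact h1
  -- Applying `δ` to the expansion leaves, for each `i`, a multiple of `fᵢ - fᵢ(q)` and a multiple
  -- of `gᵢ(f) - ∂ᵢh(f)`. Both functions vanish at `q`, the second because `gᵢ` and `∂ᵢh` agree at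
  -- `f(q)`.
  have hE : D V (F.scalar V.1 (M.ofReal (M.compose h hh f))) -
      ∑ i, F.scalar V.1 (M.ofReal (M.compose (MildlySingularManifold.partialDeriv h i)
          (MildlySingularManifold.contDiff_partialDeriv hh i) f)) *
        D V (F.scalar V.1 (M.ofReal (f i))) =
      ∑ i, (F.scalar V.1 (M.ofReal (f i) - algebraMap ℂ _ ((f i).1 ⟨q, hW hq⟩ : ℂ)) *
          δ (M.ofReal (M.compose (g i) (hg i) f)) +
        F.scalar V.1 (M.ofReal (M.compose (g i) (hg i) f) -
          M.ofReal (M.compose (MildlySingularManifold.partialDeriv h i)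
            (MildlySingularManifold.contDiff_partialDeriv hh i) f)) * δ (M.ofReal (f i))) := by
    have h1 : D V (F.scalar V.1 (M.ofReal (M.compose h hh f))) =
      δ (M.ofReal (M.compose h hh f)) := rfl
    rw [h1, hexp, map_add, hconst, zero_add, map_sum, ← Finset.sum_sub_distrib]
    refine Finset.sum_congr rfl fun i _ => ?_
    have h2 : D V (F.scalar V.1 (M.ofReal (f i))) = δ (M.ofReal (f i)) := rfl
    rw [hmul, map_sub δ, hconst, sub_zero, h2,
      ← F.scalar_mul_comm (M.ofReal (f i) - _), map_sub (F.scalar V.1)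
      (M.ofReal (M.compose (g i) (hg i) f)), sub_mul, add_sub_assoc]
  rw [hE]
  show End.evalAt W hW t _ ∈ _
  rw [map_sum]
  refine Submodule.sum_mem _ fun i _ => ?_
  rw [map_add]
  refine add_mem (Submodule.smul_mem_smul ?_ trivial) (Submodule.smul_mem_smul ?_ trivial)
  · exact sub_self (((f i).1 ⟨q, hW hq⟩ : ℝ) : ℂ)
  · exact sub_eq_zero.2 (congrArg (fun r : ℝ => (r : ℂ)) (hg0 i))

end ModPresheaf

/-- Without singularities in `V` a section is nothing but its family of fibre values, and a product
`f • x` with `f(q) = 0` has value zero at `q`. -/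
theorem TameSettlement.sections_eq_zero {M : MildlySingularManifold n Y}
    {P : RegularPartition.{u, w} M} (𝔖 : TameSettlement.{u, v, w} P) {V : Opens Y}
    (hV : V ≤ M.smoothLocus) (t : 𝔖.sections.sec V) (ht : ∀ (q : Y) (hq : q ∈ V),
      t ∈ M.idealAt V q hq • (⊤ : Submodule (M.smoothC V) (𝔖.sections.sec V))) : t = 0 := by
  refine sections_ext (fun q => ?_) fun p => (hV p.2.1 p.2.2).elim
  have h := ht q.1 q.2.1
  clear ht
  induction h using Submodule.smul_induction_on' with
  | smul f hf x hx =>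
    show f.1 ⟨q.1, q.2.1⟩ • x.1.1 q = 0
    rw [show f.1 ⟨q.1, q.2.1⟩ = 0 from hf, zero_smul]
  | add x hx y hy ihx ihy =>
    show x.1.1 q + y.1.1 q = 0
    have hx' : x.1.1 q = 0 := ihx
    have hy' : y.1.1 q = 0 := ihy
    rw [hx', hy', add_zero]

end AzumayaType

/-! ### Duality, pairing and chain rule for a tame settlement -/

theorem lemma3p2p9 {n : ℕ} {Y : Type u} [TopologicalSpace Y]
    (M : AzumayaType.MildlySingularManifold n Y) (P : AzumayaType.RegularPartition.{u, w} M)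
    (𝔖 : AzumayaType.TameSettlement.{u, v, w} P) :
    ∃ ι : ∀ U : TopologicalSpace.Opens Y, 𝔖.sections.tangent U ≃ₗ[M.smoothC U] 𝔖.sections.biHom U,
      (∀ (U V : TopologicalSpace.Opens Y) (h : V ≤ U) (ξ : 𝔖.sections.tangent U),
        ι V (𝔖.sections.tanRes h ξ) = 𝔖.sections.biHomRes h (ι U ξ)) ∧
      (∀ (U : TopologicalSpace.Opens Y) (ξ : 𝔖.sections.tangent U) (V : Set.Iic U) (a b c : 𝔖.sections.End V.1),
        (ι U ξ).1 V (a • MulOpposite.op c • 𝔖.sections.d b) = a * ξ.1 V b * c) ∧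
      (∃ B : ∀ U : TopologicalSpace.Opens Y, 𝔖.sections.tangent U ⊗[M.smoothC U] 𝔖.sections.cotangent U
          →ₗ[M.smoothC U] 𝔖.sections.End U,
        (∀ (U V : TopologicalSpace.Opens Y) (h : V ≤ U) (ξ : 𝔖.sections.tangent U) (θ : 𝔖.sections.cotangent U),
          B V (𝔖.sections.tanRes h ξ ⊗ₜ 𝔖.sections.cotRes h θ) =
            𝔖.sections.endRes h (B U (ξ ⊗ₜ θ))) ∧
        (∀ (U : TopologicalSpace.Opens Y) (ξ : 𝔖.sections.tangent U) (θ : 𝔖.sections.cotangent U),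
          B U (ξ ⊗ₜ θ) = (ι U ξ).1 ⟨U, le_refl U⟩ θ) ∧
        (∀ (U : TopologicalSpace.Opens Y) (ξ : 𝔖.sections.tangent U) (a b c : 𝔖.sections.End U),
          B U (ξ ⊗ₜ (a • MulOpposite.op c • 𝔖.sections.d b)) = a * ξ.1 ⟨U, le_refl U⟩ b * c) ∧
        (∀ (U : TopologicalSpace.Opens Y) (ξ ξ' : 𝔖.sections.tangent U),
          (∀ (V : TopologicalSpace.Opens Y) (h : V ≤ U) (θ : 𝔖.sections.cotangent V),
            B V (𝔖.sections.tanRes h ξ ⊗ₜ θ) = B V (𝔖.sections.tanRes h ξ' ⊗ₜ θ)) → ξ = ξ')) ∧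
      (∀ U : TopologicalSpace.Opens Y, U ≤ M.smoothLocus →
        ∀ D : 𝔖.sections.LocalMaps (fun V => 𝔖.sections.End V) U,
          𝔖.sections.IsDerivation D → D ∈ 𝔖.sections.tangent U) := by
  have hF : 𝔖.sections.IsSheaf := AzumayaType.TameSettlement.isSheaf_sections
  refine ⟨AzumayaType.ModPresheaf.tangentEquiv hF,
    fun U V h ξ => AzumayaType.ModPresheaf.tangentEquiv_tanRes hF h ξ,
    fun U ξ V a b c => AzumayaType.ModPresheaf.tangentEquiv_apply hF ξ V a b c,
    ⟨AzumayaType.ModPresheaf.pairing hF, fun U V h ξ θ => ?_, fun U ξ θ => rfl,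
      fun U ξ a b c => AzumayaType.ModPresheaf.tangentEquiv_apply hF ξ ⟨U, le_refl U⟩ a b c,
      fun U ξ ξ' h => ?_⟩,
    fun U hU D hD => ⟨hD, hD.satisfiesChainRule fun V hV =>
      𝔖.sections_eq_zero (hV.trans hU)⟩⟩
  -- The pairing is compatible with restriction because `ι` is and because `ι ξ` is itself a map of
  -- sheaves.
  · rw [AzumayaType.ModPresheaf.pairing_tmul, AzumayaType.ModPresheaf.pairing_tmul,
      AzumayaType.ModPresheaf.tangentEquiv_tanRes hF h]
    exact ((AzumayaType.ModPresheaf.tangentEquiv hF U ξ).2.1 ⟨U, le_refl U⟩ ⟨V, h⟩ h θ).symm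
  · refine Subtype.ext (funext fun V => funext fun b => ?_)
    -- Testing against `1 (db) 1` over `V` recovers `ξ b`.
    have h1 := h V.1 V.2 ((1 : 𝔖.sections.End V.1) •
      MulOpposite.op (1 : 𝔖.sections.End V.1) • 𝔖.sections.d b)
    rw [AzumayaType.ModPresheaf.pairing_tmul, AzumayaType.ModPresheaf.pairing_tmul,
      AzumayaType.ModPresheaf.tangentEquiv_apply, AzumayaType.ModPresheaf.tangentEquiv_apply,
      one_mul, mul_one, one_mul, mul_one] at h1
    exact h1
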